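/- \textbf{Theorem 1 (General bound).} Consider a quantum system of finitely many finite-dimensional sites with a fixed Hermitian interaction $H_{\rm int}$. Call a Hamiltonian \emph{admissible} if it has the form $H_{\rm ext}+H_{\rm int}$, where $H_{\rm ext}$ is a sum of on-site Hermitian terms. Let $\mathcal R$ be the set of unitaries generated ($\hbar=1$), in some time $\tau\ge 0$, by $H(t)=H_{\rm ext}(t)+H_{\rm int}$ along some integrable trajectory of the on-site fields. Let $T_h>T_c>0$ ($k_B=1$), let $\omega_i^J=e^{-H^J/T_i}/\operatorname{Tr}e^{-H^J/T_i}$ for $i\in\{h,c\}$, let $S$ be the von Neumann entropy and $D(\cdot\|\cdot)$ the relative entropy, and put $\Delta S^{B,D}=S(\omega_h^B)-S(\omega_c^D)$. All minima below are understood as infima. A \emph{cycle} is a periodically repeated finite sequence of operations on pairs (state, admissible Hamiltonian), in any order and number, such that state and Hamiltonian return to their initial values. The operations are evolutions $(\rho,H)\mapsto(U\rho U^\dagger,H')$ with $U\in\mathcal R$ and $H'$ admissible (the fields may jump at the ends of a trajectory; $U=\mathbb 1$ is a quench), and thermal contacts $(\rho,H)\mapsto(e^{-H/T_i}/\operatorname{Tr}e^{-H/T_i},H)$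 with the hot ($i=h$) or the cold ($i=c$) bath. Per cycle, the work $W$ is the sum of $\operatorname{Tr}(\rho H)-\operatorname{Tr}(\rho'H')$ over the evolutions $(\rho,H)\mapsto(\rho',H')$, the heat $Q_h$ is the sum of $\operatorname{Tr}(\rho'H)-\operatorname{Tr}(\rho H)$ over the hot contacts $(\rho,H)\mapsto(\rho',H)$, and the efficiency is $\eta=W/|Q_h|$. (i) \emph{Bound.} If $W>0$, then $Q_h>0$. If $Q_h>0$, then the cycle contains a run of consecutive hot contacts (evolutions may lie between them), preceded and followed by cold contacts, such that, with $H^A$ and $H^B$ the Hamiltonians at the first and the last hot contact of the run, $H^D$ the one at the last cold contact before it, and $H^C$ the one at the first cold contact after it, $$\Delta S^{B,D}-\min_{V\in\mathcal R}D(V\omega_c^DV^\dagger\|\omega_h^A)>0,\qquad \eta\le 1-\frac{T_c}{T_h}\left(\frac{\Delta S^{B,D}+\min_{U\in\mathcal R}D(U\omega_h^BU^\dagger\|\omega_c^C)}{\Delta S^{B,D}-\min_{V\in\mathcal R}D(V\omega_c^DV^\dagger\|\omega_h^A)}\right).$$ (If all hot contacts of a period are consecutive, the run, and hence $H^A,\dots,H^D$,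 is unique.) (ii) \emph{Carnot-like protocols.} For admissible $H^A,H^B,H^C,H^D$ and $U,V\in\mathcal R$, the Carnot-like protocol with $m\ge1$ steps is the cycle made of: the evolution $V$ from $H^D$ to $H^A$; $m+1$ hot contacts at the Hamiltonians $H^A+\frac jm(H^B-H^A)$, $0\le j\le m$, linked by quenches; the evolution $U$ from $H^B$ to $H^C$; $m+1$ cold contacts at $H^C+\frac jm(H^D-H^C)$, $0\le j\le m$, linked by quenches. If $\Delta S^{B,D}-D(V\omega_c^DV^\dagger\|\omega_h^A)>0$, then $Q_h>0$ for all large $m$, and as $m\to\infty$ $$\eta\to 1-\frac{T_c}{T_h}\left(\frac{\Delta S^{B,D}+D(U\omega_h^BU^\dagger\|\omega_c^C)}{\Delta S^{B,D}-D(V\omega_c^DV^\dagger\|\omega_h^A)}\right).$$ (iii) \emph{Saturation.} Consequently, for all admissible $H^A,H^B,H^C,H^D$ with $\Delta S^{B,D}-\min_{V\in\mathcal R}D(V\omega_c^DV^\dagger\|\omega_h^A)>0$, the right-hand side of the bound in (i) is approximated arbitrarily well by the efficiencies of Carnot-like protocols with these Hamiltonians, $U,V\in\mathcal R$ and $Q_h>0$.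 -/

import Mathlib

open Matrix
open scoped ComplexOrder

namespace QEngine

noncomputable section

/-- Operators on the Hilbert space `⨂ j, ℂ^(κ j)` of a many-body system with sites `j : ι`,
as matrices in the product basis. -/
abbrev Operator {ι : Type*} (κ : ι → Type*) := Matrix (∀ j, κ j) (∀ j, κ j) ℂ

/-- An assignment `j ↦ h j` of an operator to every site (the external fields). -/
abbrev Fields {ι : Type*} (κ : ι → Type*) := ∀ j, Matrix (κ j) (κ j) ℂ

variable {ι : Type*} [Fintype ι] [DecidableEq ι]
  {κ : ι → Type*} [∀ j, Fintype (κ j)] [∀ j, DecidableEq (κ j)]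

/-- `1 ⊗ ⋯ ⊗ h ⊗ ⋯ ⊗ 1`, the operator `h` acting on site `j` only. -/
def onSite (j : ι) (h : Matrix (κ j) (κ j) ℂ) : Operator κ :=
  fun a b => if ∀ k, k ≠ j → a k = b k then h (a j) (b j) else 0

/-- `H_ext + H_int` for the on-site fields `h`. -/
def hamiltonian (Hint : Operator κ) (h : Fields κ) : Operator κ :=
  ∑ j, onSite j (h j) + Hint

/-- Hamiltonians of the form `H_ext + H_int` with `H_int` fixed and Hermitian on-site fields. -/
def IsAdmissible (Hint H : Operator κ) : Prop :=
  ∃ h : Fields κ, (∀ j, (h j).IsHermitian) ∧ H = hamiltonian Hint h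

/-- `Y` solves `Y(0) = 1`, `i Y'(t) = H(t) Y(t)` on `[0, τ]` (`ħ = 1`), in integrated form, for
`H(t) = H_ext(t) + H_int` given by integrable on-site fields `h(t)`. -/
def IsPropagator (Hint : Operator κ) (τ : ℝ) (h : ℝ → Fields κ) (Y : ℝ → Operator κ) : Prop :=
  (∀ t j, (h t j).IsHermitian) ∧
  (∀ j p q, IntervalIntegrable (fun s => h s j p q) MeasureTheory.volume 0 τ) ∧
  ContinuousOn Y (Set.Icc 0 τ) ∧
  ∀ t ∈ Set.Icc 0 τ, ∀ a b,
    Y t a b = (1 : Operator κ) a b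
      - Complex.I * ∫ s in (0 : ℝ)..t, (hamiltonian Hint (h s) * Y s) a b

/-- The unitaries induced in some time `τ ≥ 0` by some trajectory of the on-site fields. -/
def reachable (Hint : Operator κ) : Set (Matrix.unitaryGroup (∀ j, κ j) ℂ) :=
  {U | ∃ τ : ℝ, 0 ≤ τ ∧ ∃ (h : ℝ → Fields κ) (Y : ℝ → Operator κ),
    IsPropagator Hint τ h Y ∧ Y τ = (U : Operator κ)}

/-- The state `U ρ U†`. -/
def conjugate (U : Matrix.unitaryGroup (∀ j, κ j) ℂ) (ρ : Operator κ) : Operator κ :=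
  (U : Operator κ) * ρ * (U : Operator κ)ᴴ

/-- Density operators. -/
def IsState (ρ : Operator κ) : Prop := ρ.PosSemidef ∧ ρ.trace = 1

/-- The mean energy `Tr (ρ H)`. -/
def energy (ρ H : Operator κ) : ℝ := (ρ * H).trace.re

/-- The Gibbs state `exp (-H / T) / Tr exp (-H / T)` at temperature `T` (`k_B = 1`). -/
def gibbs (T : ℝ) (H : Operator κ) : Operator κ :=
  (NormedSpace.exp (-((T⁻¹ : ℝ) : ℂ) • H)).trace⁻¹ • NormedSpace.exp (-((T⁻¹ : ℝ) : ℂ) • H)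

/-- The von Neumann entropy `-Tr (ρ log ρ)`, with `0 log 0 = 0`. -/
def entropy (ρ : Operator κ) : ℝ := -(ρ * cfc Real.log ρ).trace.re

/-- The relative entropy `D(ρ‖σ) = Tr (ρ (log ρ - log σ))`, for `σ` of full rank (below `σ` is
always a Gibbs state, so that the value `+∞` does not occur). -/
def relEntropy (ρ σ : Operator κ) : ℝ := (ρ * (cfc Real.log ρ - cfc Real.log σ)).trace.re

/-- The two heat baths. -/
inductive Bath
  | hot
  | cold

/-- The temperature of a bath. -/
def Bath.temp (Th Tc : ℝ) : Bath → ℝ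
  | .hot => Th
  | .cold => Tc

variable (κ) in
/-- The two kinds of operations: an evolution with propagator `U`, or a thermal contact. -/
inductive Operation
  | evolution (U : Matrix.unitaryGroup (∀ j, κ j) ℂ)
  | contact (b : Bath)

/-- The effect of an operation on the pair (state, Hamiltonian): an evolution takes `(ρ, H)` to
`(U ρ U†, H')` with `U` reachable (the Hamiltonian may jump at the ends of a trajectory, so that
`H'` is not tied to `U`; `U = 1` is a quench), and a thermal contact takes `(ρ, H)` to
`(gibbs T H, H)`. -/
def Operation.Effect (Hint : Operator κ) (Th Tc : ℝ) :
    Operation κ → Operator κ → Operator κ → Operator κ → Operator κ → Prop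
  | .evolution U, ρ, _, ρ', _ => U ∈ reachable Hint ∧ ρ' = conjugate U ρ
  | .contact b, _, H, ρ', H' => ρ' = gibbs (b.temp Th Tc) H ∧ H' = H

/-- A cyclic protocol: operation `i` takes `(ρ i, H i)` to `(ρ (i+1), H (i+1))`, and everything
is periodic, `period` being the number of operations in one cycle. -/
structure Cycle (Hint : Operator κ) (Th Tc : ℝ) where
  /-- number of operations in one cycle -/
  period : ℕ
  /-- the operations -/
  op : ℕ → Operation κ
  /-- the states -/
  state : ℕ → Operator κ
  /-- the Hamiltonians -/
  ham : ℕ → Operator κ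
  period_pos : 0 < period
  isState : ∀ i, IsState (state i)
  isAdmissible : ∀ i, IsAdmissible Hint (ham i)
  effect : ∀ i, (op i).Effect Hint Th Tc (state i) (ham i) (state (i + 1)) (ham (i + 1))
  op_periodic : ∀ i, op (i + period) = op i
  state_periodic : ∀ i, state (i + period) = state i
  ham_periodic : ∀ i, ham (i + period) = ham i

namespace Cycle

variable {Hint : Operator κ} {Th Tc : ℝ}

/-- The mean energy before operation `i`. -/
def energyAt (P : Cycle Hint Th Tc) (i : ℕ) : ℝ := energy (P.state i) (P.ham i)

/-- The expected work extracted in one cycle: the sum of `Tr (ρ i H i) - Tr (ρ (i+1) H (i+1))`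
over the evolutions. -/
def work (P : Cycle Hint Th Tc) : ℝ :=
  ∑ i ∈ Finset.range P.period,
    match P.op i with
    | .evolution _ => P.energyAt i - P.energyAt (i + 1)
    | .contact _ => 0

/-- The heat `Q_h` provided by the hot bath in one cycle: the sum of
`Tr (ω_h H i) - Tr (ρ i H i)` over the contacts with the hot bath. -/
def heatHot (P : Cycle Hint Th Tc) : ℝ :=
  ∑ i ∈ Finset.range P.period,
    match P.op i with
    | .contact .hot => P.energyAt (i + 1) - P.energyAt i
    | _ => 0

/-- The efficiency `W / |Q_h|`. -/
def efficiency (P : Cycle Hint Th Tc) : ℝ := P.work / |P.heatHot|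

/-- A hot run: operations `a ≤ b` are contacts with the hot bath, with no contact with the cold
bath in between; `d` is the last contact before `a` and `c` the first contact after `b`, and both
are contacts with the cold bath. -/
def IsHotRun (P : Cycle Hint Th Tc) (a b c d : ℕ) : Prop :=
  d < a ∧ a ≤ b ∧ b < c ∧
  P.op d = .contact .cold ∧ P.op a = .contact .hot ∧
  P.op b = .contact .hot ∧ P.op c = .contact .cold ∧
  (∀ i, d < i → i < a → ∀ x, P.op i ≠ .contact x) ∧
  (∀ i, a < i → i < b → P.op i ≠ .contact .cold) ∧
  (∀ i, b < i → i < c → ∀ x, P.op i ≠ .contact x)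

/-- A Carnot-like protocol. In this order: the evolution `V`, ending at the Hamiltonian `A`; an
isothermal from `A` to `B` with the hot bath; the evolution `U`, ending at `C`; an isothermal from
`C` to `D` with the cold bath. An isothermal from `H` to `H'` in `m` steps consists of contacts at
the Hamiltonians `H + (j / m) (H' - H)`, `0 ≤ j ≤ m`, linked by quenches. -/
structure IsCarnotLike (P : Cycle Hint Th Tc) (U V : Matrix.unitaryGroup (∀ j, κ j) ℂ)
    (A B C D : Operator κ) (m : ℕ) : Prop where
  period_eq : P.period = 4 * (m + 1)
  evolution_V : P.op 0 = .evolution V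
  hot_contact : ∀ j ≤ m, P.op (2 * j + 1) = .contact .hot ∧
    P.ham (2 * j + 1) = A + ((j : ℂ) / (m : ℂ)) • (B - A)
  hot_quench : ∀ j, 1 ≤ j → j ≤ m → P.op (2 * j) = .evolution 1
  evolution_U : P.op (2 * (m + 1)) = .evolution U
  cold_contact : ∀ j ≤ m, P.op (2 * (m + 1 + j) + 1) = .contact .cold ∧
    P.ham (2 * (m + 1 + j) + 1) = C + ((j : ℂ) / (m : ℂ)) • (D - C)
  cold_quench : ∀ j, 1 ≤ j → j ≤ m → P.op (2 * (m + 1 + j)) = .evolution 1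

end Cycle

/-- `ΔS^{B,D} = S(ω_h^B) - S(ω_c^D)`. -/
def deltaS (Th Tc : ℝ) (B D : Operator κ) : ℝ := entropy (gibbs Th B) - entropy (gibbs Tc D)

/-- `D(U ω^H_T U† ‖ ω^{H'}_{T'})`. -/
def dissipation (U : Matrix.unitaryGroup (∀ j, κ j) ℂ) (T : ℝ) (H : Operator κ)
    (T' : ℝ) (H' : Operator κ) : ℝ :=
  relEntropy (conjugate U (gibbs T H)) (gibbs T' H')

/-- The minimal dissipation: the infimum of `D(U ω^H_T U† ‖ ω^{H'}_{T'})` over the reachable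
unitaries `U`. -/
def minDissipation (Hint : Operator κ) (T : ℝ) (H : Operator κ)
    (T' : ℝ) (H' : Operator κ) : ℝ :=
  ⨅ U : reachable Hint, dissipation (U : Matrix.unitaryGroup (∀ j, κ j) ℂ) T H T' H'

end

end QEngine

open QEngine Filter Topology

/-!
A contact with a bath at temperature `T` takes `ρ` to the Gibbs state `ω` and draws the heat `Q`
with `Q / T = S(ω) - S(ρ) - D(ρ‖ω)` (`relEntropy_gibbs`), and evolutions conserve the entropy.
As `D ≥ 0` (Klein's inequality, `klein`), summing over a period gives the Clausius inequality
`Q_h / T_h + Q_c / T_c ≤ 0`, and so `Q_h > 0` if `W = Q_h + Q_c > 0`.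

For the bound, the period is cut into hot runs and the cold runs after them. The evolutions
between two contacts compose to one reachable unitary (`mul_mem_reachable`), so that the contact
that opens a run produces at least the minimal dissipation between the Hamiltonians at its ends.
A hot run therefore draws at most `x = ΔS - min D(V ω_c^D V†‖ω_h^A)` from the hot bath, in units
of entropy, and, up to terms that telescope over the period, the following cold run delivers at
least `y = ΔS + min D(U ω_h^B U†‖ω_c^C)` to the cold bath. Let `k` be the ratio of these two
entropies for the whole cycle; `k ≥ 1` by the Clausius inequality. If `y > k x` in all runs with
`x > 0`, then `y ≥ k x` in all runs, because `y ≥ x` and `k ≥ 1`, and summation contradicts the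
choice of `k`. Hence some run has `x > 0` and `y / x ≤ k` (`Cycle.exists_isHotRun`), which is the
bound. The decomposition into runs is not formalized as such: the summation is an induction in
time over the operations, with the running totals of the current run as the invariant
(`Cycle.coldPhase_or_hotPhase`).

In a Carnot-like protocol the entropy balance is exact, up to the losses
`∑ j, D(ω_j‖ω_{j+1})` of the two isothermals. Adding `D(ω_{j+1}‖ω_j) ≥ 0` to each term gives
`Tr ((ω_j - ω_{j+1}) (B - A)) / (m T)`, whose sum telescopes; so the losses are `O(1/m)`
(`isothermalLoss_le`) without any perturbation theory. Saturation follows by continuity.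
-/

set_option linter.unusedSectionVars false

namespace QEngine

/-! ### Functional calculus in an eigenbasis -/

section Spectral

variable {n : Type*} [Fintype n] [DecidableEq n]

/-- The matrix `R diag(d) R†` with eigenvalues `d` and eigenvectors the columns of `R`. -/
noncomputable def unitaryDiagonal (R : Matrix.unitaryGroup n ℂ) (d : n → ℝ) : Matrix n n ℂ :=
  (R : Matrix n n ℂ) * diagonal (fun i => (d i : ℂ)) * (R : Matrix n n ℂ)ᴴ

lemma conjTranspose_mul_self_unitary (R : Matrix.unitaryGroup n ℂ) :
    (R : Matrix n n ℂ)ᴴ * (R : Matrix n n ℂ) = 1 :=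
  Matrix.mem_unitaryGroup_iff'.mp R.2

lemma mul_conjTranspose_self_unitary (R : Matrix.unitaryGroup n ℂ) :
    (R : Matrix n n ℂ) * (R : Matrix n n ℂ)ᴴ = 1 :=
  Matrix.mem_unitaryGroup_iff.mp R.2

lemma isHermitian_eq_unitaryDiagonal {A : Matrix n n ℂ} (hA : A.IsHermitian) :
    A = unitaryDiagonal hA.eigenvectorUnitary hA.eigenvalues := by
  conv_lhs => rw [hA.spectral_theorem]
  rw [Unitary.conjStarAlgAut_apply]
  rfl

lemma isHermitian_unitaryDiagonal (R : Matrix.unitaryGroup n ℂ) (d : n → ℝ) :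
    (unitaryDiagonal R d).IsHermitian := by
  unfold unitaryDiagonal
  apply Matrix.isHermitian_mul_mul_conjTranspose
  rw [Matrix.isHermitian_diagonal_iff]
  intro i
  simp [IsSelfAdjoint]

lemma conj_unitaryDiagonal (U R : Matrix.unitaryGroup n ℂ) (d : n → ℝ) :
    (U : Matrix n n ℂ) * unitaryDiagonal R d * (U : Matrix n n ℂ)ᴴ =
      unitaryDiagonal (U * R) d := by
  simp [unitaryDiagonal, Matrix.conjTranspose_mul, Matrix.mul_assoc]

lemma trace_conj_unitary (U : Matrix.unitaryGroup n ℂ) (A : Matrix n n ℂ) :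
    ((U : Matrix n n ℂ) * A * (U : Matrix n n ℂ)ᴴ).trace = A.trace := by
  rw [Matrix.trace_mul_comm, ← Matrix.mul_assoc, conjTranspose_mul_self_unitary, Matrix.one_mul]

lemma trace_unitaryDiagonal (R : Matrix.unitaryGroup n ℂ) (d : n → ℝ) :
    (unitaryDiagonal R d).trace = ((∑ i, d i : ℝ) : ℂ) := by
  rw [unitaryDiagonal, trace_conj_unitary, Matrix.trace_diagonal]
  push_cast
  rfl

/-- On the finite spectrum `f` agrees with an interpolating polynomial, and polynomials commute
with the conjugation by `R`. -/
lemma cfc_unitaryDiagonal (f : ℝ → ℝ) (R : Matrix.unitaryGroup n ℂ) (d : n → ℝ) :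
    cfc f (unitaryDiagonal R d) = unitaryDiagonal R (fun i => f (d i)) := by
  classical
  let p : Polynomial ℝ := Lagrange.interpolate (Finset.univ.image d) id f
  have hp : ∀ i, p.eval (d i) = f (d i) := fun i =>
    Lagrange.eval_interpolate_at_node (v := id) f (Set.injOn_id _)
      (Finset.mem_image_of_mem d (Finset.mem_univ i))
  have hspec : Set.EqOn f (fun x => p.eval x) (spectrum ℝ (unitaryDiagonal R d)) := by
    intro x hx
    rw [← spectrum.algebraMap_mem_iff ℂ, unitaryDiagonal, ← Matrix.star_eq_conjTranspose,
      Unitary.spectrum_star_right_conjugate, spectrum_diagonal] at hx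
    obtain ⟨i, hi⟩ := hx
    have hi' : d i = x := by
      apply Complex.ofReal_injective
      simpa using hi
    rw [← hi']
    exact (hp i).symm
  rw [cfc_congr hspec, cfc_polynomial p _ (isHermitian_unitaryDiagonal R d).isSelfAdjoint]
  have h1 : unitaryDiagonal R d =
      Unitary.conjStarAlgAut ℝ (Matrix n n ℂ) R
        (Matrix.diagonalAlgHom ℝ (fun i => (d i : ℂ))) := by
    rw [Unitary.conjStarAlgAut_apply]; rfl
  rw [h1, Polynomial.aeval_algHom_apply, Polynomial.aeval_algHom_apply,
    Unitary.conjStarAlgAut_apply]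
  have h2 : (Polynomial.aeval (fun i => (d i : ℂ))) p = fun i => ((f (d i) : ℝ) : ℂ) := by
    ext i
    have h3 := Polynomial.aeval_algHom_apply (Pi.evalAlgHom ℝ (fun _ : n => ℂ) i)
      (fun i => (d i : ℂ)) p
    rw [← hp i]
    exact h3.symm.trans (Polynomial.aeval_algebraMap_apply_eq_algebraMap_eval (d i) p)
  rw [h2]
  rfl

lemma exp_unitaryDiagonal (R : Matrix.unitaryGroup n ℂ) (d : n → ℝ) :
    NormedSpace.exp (unitaryDiagonal R d) = unitaryDiagonal R (fun i => Real.exp (d i)) := by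
  have hinv : (R : Matrix n n ℂ)ᴴ = (R : Matrix n n ℂ)⁻¹ :=
    (Matrix.inv_eq_right_inv (mul_conjTranspose_self_unitary R)).symm
  have hunit : IsUnit (R : Matrix n n ℂ) :=
    IsUnit.of_mul_eq_one _ (mul_conjTranspose_self_unitary R)
  unfold unitaryDiagonal
  rw [hinv, Matrix.exp_conj _ _ hunit, Matrix.exp_diagonal]
  congr 3
  ext i
  rw [Pi.coe_exp, ← Complex.exp_eq_exp_ℂ, Complex.ofReal_exp]

lemma smul_unitaryDiagonal (c : ℝ) (R : Matrix.unitaryGroup n ℂ) (d : n → ℝ) :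
    (c : ℂ) • unitaryDiagonal R d = unitaryDiagonal R (fun i => c * d i) := by
  simp only [unitaryDiagonal]
  rw [← Matrix.smul_mul, ← Matrix.mul_smul, ← Matrix.diagonal_smul]
  congr 3
  ext i
  simp

lemma unitaryDiagonal_sub_const (R : Matrix.unitaryGroup n ℂ) (d : n → ℝ) (c : ℝ) :
    unitaryDiagonal R (fun i => d i - c) = unitaryDiagonal R d - (c : ℂ) • 1 := by
  have : (fun i => ((d i - c : ℝ) : ℂ)) = fun i => (d i : ℂ) - (c : ℂ) := by
    ext i; simp
  simp only [unitaryDiagonal]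
  rw [this, ← Matrix.diagonal_sub, Matrix.mul_sub, Matrix.sub_mul, ← Matrix.smul_one_eq_diagonal,
    Matrix.mul_smul, Matrix.smul_mul, Matrix.mul_one, mul_conjTranspose_self_unitary]

lemma unitaryDiagonal_mul (R : Matrix.unitaryGroup n ℂ) (d e : n → ℝ) :
    unitaryDiagonal R d * unitaryDiagonal R e = unitaryDiagonal R (fun i => d i * e i) := by
  simp only [unitaryDiagonal, Complex.ofReal_mul]
  rw [← Matrix.diagonal_mul_diagonal]
  simp only [Matrix.mul_assoc]
  rw [← Matrix.mul_assoc _ (R : Matrix n n ℂ) (diagonal _ * _), conjTranspose_mul_self_unitary,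
    Matrix.one_mul]

lemma cfc_conj_unitary (f : ℝ → ℝ) (U : Matrix.unitaryGroup n ℂ) {A : Matrix n n ℂ}
    (hA : A.IsHermitian) :
    cfc f ((U : Matrix n n ℂ) * A * (U : Matrix n n ℂ)ᴴ) =
      (U : Matrix n n ℂ) * cfc f A * (U : Matrix n n ℂ)ᴴ := by
  rw [isHermitian_eq_unitaryDiagonal hA, conj_unitaryDiagonal, cfc_unitaryDiagonal,
    cfc_unitaryDiagonal, conj_unitaryDiagonal]

lemma trace_mul_unitaryDiagonal (W R : Matrix.unitaryGroup n ℂ) (p q : n → ℝ) :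
    (unitaryDiagonal W p * unitaryDiagonal R q).trace =
      ((∑ i, ∑ j, p i * Complex.normSq ((W⁻¹ * R : Matrix.unitaryGroup n ℂ) i j) * q j : ℝ) : ℂ)
      := by
  set N : Matrix.unitaryGroup n ℂ := W⁻¹ * R with hN
  have hNv : (N : Matrix n n ℂ) = (W : Matrix n n ℂ)ᴴ * (R : Matrix n n ℂ) := rfl
  have h1 : (unitaryDiagonal W p * unitaryDiagonal R q).trace =
      (diagonal (fun i => (p i : ℂ)) * ((N : Matrix n n ℂ) * diagonal (fun i => (q i : ℂ)) *
        (N : Matrix n n ℂ)ᴴ)).trace := by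
    unfold unitaryDiagonal
    rw [Matrix.mul_assoc, Matrix.mul_assoc, Matrix.trace_mul_comm, hNv, Matrix.conjTranspose_mul,
      Matrix.conjTranspose_conjTranspose]
    simp only [Matrix.mul_assoc]
  rw [h1, Matrix.trace]
  push_cast
  refine Finset.sum_congr rfl fun i _ => ?_
  rw [Matrix.diag_apply, Matrix.diagonal_mul, Matrix.mul_apply, Finset.mul_sum]
  refine Finset.sum_congr rfl fun j _ => ?_
  rw [Matrix.mul_diagonal, Matrix.conjTranspose_apply, Complex.normSq_eq_conj_mul_self]
  simp only [RCLike.star_def]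
  ring

lemma sum_normSq_row (N : Matrix.unitaryGroup n ℂ) (i : n) :
    ∑ j, Complex.normSq (N i j) = 1 := by
  have h := congrFun (congrFun (mul_conjTranspose_self_unitary N) i) i
  rw [Matrix.mul_apply, Matrix.one_apply_eq] at h
  apply Complex.ofReal_injective
  push_cast
  rw [← h]
  refine Finset.sum_congr rfl fun j _ => ?_
  rw [Matrix.conjTranspose_apply, Complex.normSq_eq_conj_mul_self, mul_comm]
  rfl

lemma sum_normSq_col (N : Matrix.unitaryGroup n ℂ) (j : n) :
    ∑ i, Complex.normSq (N i j) = 1 := by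
  have h := congrFun (congrFun (conjTranspose_mul_self_unitary N) j) j
  rw [Matrix.mul_apply, Matrix.one_apply_eq] at h
  apply Complex.ofReal_injective
  push_cast
  rw [← h]
  refine Finset.sum_congr rfl fun j _ => ?_
  rw [Matrix.conjTranspose_apply, Complex.normSq_eq_conj_mul_self]
  rfl

/-- The scalar inequality behind Klein's inequality; it is `log x ≤ x - 1` at `x = q / p`. -/
lemma sub_le_mul_log_sub_log {p q : ℝ} (hp : 0 ≤ p) (hq : 0 < q) :
    p - q ≤ p * (Real.log p - Real.log q) := by
  rcases hp.eq_or_lt with rfl | hp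
  · simp [hq.le]
  · have h := Real.log_le_sub_one_of_pos (div_pos hq hp)
    rw [Real.log_div hq.ne' hp.ne'] at h
    have h2 := mul_le_mul_of_nonneg_left h hp.le
    have h3 : p * (q / p - 1) = q - p := by field_simp
    linarith

/-- **Klein's inequality**: `|⟨i|j⟩|²` is doubly stochastic for two orthonormal eigenbases, which
reduces the claim to a scalar inequality for each pair of eigenvalues. -/
lemma klein (W R : Matrix.unitaryGroup n ℂ) {p q : n → ℝ} (hp : ∀ i, 0 ≤ p i)
    (hq : ∀ i, 0 < q i) (hpq : ∑ i, p i = ∑ i, q i) :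
    0 ≤ (unitaryDiagonal W p * (cfc Real.log (unitaryDiagonal W p) -
      cfc Real.log (unitaryDiagonal R q))).trace.re := by
  set N : Matrix.unitaryGroup n ℂ := W⁻¹ * R
  have hself : (unitaryDiagonal W p * cfc Real.log (unitaryDiagonal W p)).trace.re =
      ∑ i, ∑ j, Complex.normSq (N i j) * (p i * Real.log (p i)) := by
    rw [cfc_unitaryDiagonal, unitaryDiagonal_mul, trace_unitaryDiagonal, Complex.ofReal_re]
    refine Finset.sum_congr rfl fun i _ => ?_
    rw [← Finset.sum_mul, sum_normSq_row, one_mul]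
  have hcross : (unitaryDiagonal W p * cfc Real.log (unitaryDiagonal R q)).trace.re =
      ∑ i, ∑ j, Complex.normSq (N i j) * (p i * Real.log (q j)) := by
    rw [cfc_unitaryDiagonal, trace_mul_unitaryDiagonal, Complex.ofReal_re]
    exact Finset.sum_congr rfl fun i _ => Finset.sum_congr rfl fun j _ => by ring
  have hzero : ∑ i, ∑ j, Complex.normSq (N i j) * (p i - q j) = 0 := by
    simp only [mul_sub, Finset.sum_sub_distrib]
    rw [Finset.sum_comm (f := fun i j => Complex.normSq (N i j) * q j)]
    simp only [← Finset.sum_mul, sum_normSq_row, sum_normSq_col, one_mul]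
    rw [hpq, sub_self]
  rw [Matrix.mul_sub, Matrix.trace_sub, Complex.sub_re, hself, hcross, ← Finset.sum_sub_distrib,
    ← hzero]
  refine Finset.sum_le_sum fun i _ => ?_
  rw [← Finset.sum_sub_distrib]
  refine Finset.sum_le_sum fun j _ => ?_
  rw [← mul_sub, ← mul_sub]
  exact mul_le_mul_of_nonneg_left (sub_le_mul_log_sub_log (hp i) (hq j)) (Complex.normSq_nonneg _)

end Spectral

/-! ### Gibbs states, entropy and relative entropy -/

section Thermo

variable {ι : Type*} [Fintype ι] [DecidableEq ι]
  {κ : ι → Type*} [∀ j, Fintype (κ j)] [∀ j, DecidableEq (κ j)]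

lemma conjugate_one (ρ : Operator κ) : conjugate 1 ρ = ρ := by
  simp [conjugate]

lemma conjugate_mul (U V : Matrix.unitaryGroup (∀ j, κ j) ℂ) (ρ : Operator κ) :
    conjugate (U * V) ρ = conjugate U (conjugate V ρ) := by
  simp [conjugate, Matrix.conjTranspose_mul, Matrix.mul_assoc]

lemma IsState.conjugate {ρ : Operator κ} (hρ : IsState ρ)
    (U : Matrix.unitaryGroup (∀ j, κ j) ℂ) : IsState (conjugate U ρ) :=
  ⟨hρ.1.mul_mul_conjTranspose_same _, by rw [QEngine.conjugate, trace_conj_unitary, hρ.2]⟩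

lemma entropy_conjugate {ρ : Operator κ} (hρ : ρ.IsHermitian)
    (U : Matrix.unitaryGroup (∀ j, κ j) ℂ) : entropy (conjugate U ρ) = entropy ρ := by
  have h : (U : Operator κ) * ρ * (U : Operator κ)ᴴ *
      ((U : Operator κ) * cfc Real.log ρ * (U : Operator κ)ᴴ) =
      (U : Operator κ) * (ρ * cfc Real.log ρ) * (U : Operator κ)ᴴ := by
    simp only [Matrix.mul_assoc]
    rw [← Matrix.mul_assoc _ (U : Operator κ) (_ * _), conjTranspose_mul_self_unitary,
      Matrix.one_mul]
  rw [entropy, entropy, conjugate, cfc_conj_unitary _ _ hρ, h, trace_conj_unitary]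

/-- A Gibbs state in an eigenbasis of its Hamiltonian: its eigenvalues are positive and sum to
`1`, and their logarithms are `-λ / T - log Z`. -/
lemma exists_gibbs_eq_unitaryDiagonal [∀ j, Nonempty (κ j)] (T : ℝ) {H : Operator κ}
    (hH : H.IsHermitian) :
    ∃ (R : Matrix.unitaryGroup (∀ j, κ j) ℂ) (q : (∀ j, κ j) → ℝ) (z : ℝ),
      gibbs T H = unitaryDiagonal R q ∧ (∀ i, 0 < q i) ∧ ∑ i, q i = 1 ∧
      cfc Real.log (gibbs T H) = -((T⁻¹ : ℝ) : ℂ) • H - (z : ℂ) • 1 := by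
  set R := hH.eigenvectorUnitary
  set e := hH.eigenvalues
  have hHe : H = unitaryDiagonal R e := isHermitian_eq_unitaryDiagonal hH
  set Z : ℝ := ∑ i, Real.exp (-T⁻¹ * e i) with hZ
  have hZpos : 0 < Z := Finset.sum_pos (fun i _ => Real.exp_pos _) Finset.univ_nonempty
  have hsmul : -((T⁻¹ : ℝ) : ℂ) • H = unitaryDiagonal R (fun i => -T⁻¹ * e i) := by
    rw [hHe, ← smul_unitaryDiagonal, Complex.ofReal_neg]
  have hg : gibbs T H = unitaryDiagonal R (fun i => Z⁻¹ * Real.exp (-T⁻¹ * e i)) := by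
    rw [gibbs, hsmul, exp_unitaryDiagonal, trace_unitaryDiagonal, ← hZ, ← Complex.ofReal_inv,
      smul_unitaryDiagonal]
  refine ⟨R, _, Real.log Z, hg, fun i => mul_pos (inv_pos.mpr hZpos) (Real.exp_pos _), ?_, ?_⟩
  · rw [← Finset.mul_sum, ← hZ, inv_mul_cancel₀ hZpos.ne']
  · rw [hg, cfc_unitaryDiagonal, hsmul, ← unitaryDiagonal_sub_const]
    congr 1
    ext i
    rw [Real.log_mul (inv_pos.mpr hZpos).ne' (Real.exp_pos _).ne', Real.log_inv, Real.log_exp]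
    ring

variable [∀ j, Nonempty (κ j)]

lemma isState_gibbs (T : ℝ) {H : Operator κ} (hH : H.IsHermitian) : IsState (gibbs T H) := by
  obtain ⟨R, q, z, hg, hq, hs, -⟩ := exists_gibbs_eq_unitaryDiagonal T hH
  rw [hg]
  constructor
  · refine Matrix.PosSemidef.mul_mul_conjTranspose_same ?_ _
    rw [Matrix.posSemidef_diagonal_iff]
    intro i
    exact_mod_cast (hq i).le
  · rw [trace_unitaryDiagonal, hs, Complex.ofReal_one]

lemma relEntropy_gibbs_nonneg (T : ℝ) {ρ H : Operator κ} (hρ : IsState ρ) (hH : H.IsHermitian) :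
    0 ≤ relEntropy ρ (gibbs T H) := by
  obtain ⟨R, q, z, hg, hq, hs, -⟩ := exists_gibbs_eq_unitaryDiagonal T hH
  have hρd := isHermitian_eq_unitaryDiagonal hρ.1.isHermitian
  have htr : ∑ i, hρ.1.isHermitian.eigenvalues i = ∑ i, q i := by
    have h := hρ.2
    rw [hρd, trace_unitaryDiagonal] at h
    rw [hs]
    exact_mod_cast h
  rw [hg, relEntropy, hρd]
  exact klein _ _ (fun i => hρ.1.eigenvalues_nonneg i) hq htr

/-- The relative entropy to a Gibbs state is the entropy produced by a thermal contact: the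
gain of entropy of the system minus the heat taken from the bath over its temperature. -/
lemma relEntropy_gibbs (T : ℝ) {ρ H : Operator κ} (hρ : IsState ρ) (hH : H.IsHermitian) :
    relEntropy ρ (gibbs T H) =
      entropy (gibbs T H) - entropy ρ - T⁻¹ * (energy (gibbs T H) H - energy ρ H) := by
  obtain ⟨R, q, z, -, -, -, hlog⟩ := exists_gibbs_eq_unitaryDiagonal T hH
  have key : ∀ σ : Operator κ, σ.trace = 1 →
      (σ * cfc Real.log (gibbs T H)).trace.re = -T⁻¹ * energy σ H - z := by
    intro σ hσ
    rw [hlog, Matrix.mul_sub, Matrix.mul_smul, Matrix.mul_smul, Matrix.mul_one, Matrix.trace_sub,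
      Matrix.trace_smul, Matrix.trace_smul, hσ, ← Complex.ofReal_neg, smul_eq_mul, smul_eq_mul,
      Complex.sub_re, Complex.re_ofReal_mul, Complex.re_ofReal_mul, Complex.one_re, mul_one,
      energy]
  have h1 := key ρ hρ.2
  have h2 := key (gibbs T H) (isState_gibbs T hH).2
  rw [relEntropy, Matrix.mul_sub, Matrix.trace_sub, Complex.sub_re, h1]
  simp only [entropy]
  rw [h2]
  ring

lemma energy_sub (ρ H H' : Operator κ) : energy ρ (H' - H) = energy ρ H' - energy ρ H := by
  simp [energy, Matrix.mul_sub, Matrix.trace_sub]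

/-- The symmetrized relative entropy of two Gibbs states at the same temperature; it is linear in
the difference of the Hamiltonians. -/
lemma relEntropy_gibbs_add_relEntropy_gibbs (T : ℝ) {H H' : Operator κ} (hH : H.IsHermitian)
    (hH' : H'.IsHermitian) :
    relEntropy (gibbs T H) (gibbs T H') + relEntropy (gibbs T H') (gibbs T H) =
      T⁻¹ * (energy (gibbs T H) (H' - H) - energy (gibbs T H') (H' - H)) := by
  rw [relEntropy_gibbs T (isState_gibbs T hH) hH', relEntropy_gibbs T (isState_gibbs T hH') hH,
    energy_sub, energy_sub]
  ring

end Thermo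

/-! ### Admissible Hamiltonians and reachable unitaries -/

section Control

variable {ι : Type*} [Fintype ι] [DecidableEq ι]
  {κ : ι → Type*} [∀ j, Fintype (κ j)] [∀ j, DecidableEq (κ j)]

lemma isHermitian_onSite (j : ι) {h : Matrix (κ j) (κ j) ℂ} (hh : h.IsHermitian) :
    (onSite j h : Operator κ).IsHermitian := by
  ext a b
  have hiff : (∀ k, k ≠ j → b k = a k) ↔ ∀ k, k ≠ j → a k = b k :=
    ⟨fun H k hk => (H k hk).symm, fun H k hk => (H k hk).symm⟩
  simp only [Matrix.conjTranspose_apply, onSite, hiff]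
  split_ifs
  · exact hh.apply _ _
  · simp

lemma IsAdmissible.isHermitian {Hint H : Operator κ} (hHint : Hint.IsHermitian)
    (hH : IsAdmissible Hint H) : H.IsHermitian := by
  obtain ⟨h, hh, rfl⟩ := hH
  refine Matrix.IsHermitian.add ?_ hHint
  simp only [Matrix.IsHermitian, Matrix.conjTranspose_sum]
  exact Finset.sum_congr rfl fun j _ => isHermitian_onSite j (hh j)

lemma IsAdmissible.add_smul_sub {Hint A B : Operator κ} (hA : IsAdmissible Hint A)
    (hB : IsAdmissible Hint B) (r : ℝ) : IsAdmissible Hint (A + (r : ℂ) • (B - A)) := by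
  obtain ⟨h, hh, rfl⟩ := hA
  obtain ⟨g, hg, rfl⟩ := hB
  refine ⟨fun j => h j + (r : ℂ) • (g j - h j), fun j => ?_, ?_⟩
  · refine (hh j).add ?_
    rw [Matrix.IsHermitian, Matrix.conjTranspose_smul, ((hg j).sub (hh j)).eq]
    simp
  · have hlin : ∀ j, (onSite j (h j + (r : ℂ) • (g j - h j)) : Operator κ) =
        onSite j (h j) + (r : ℂ) • (onSite j (g j) - onSite j (h j)) := by
      intro j
      ext a b
      simp only [onSite, Matrix.add_apply, Matrix.smul_apply, Matrix.sub_apply]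
      split_ifs <;> simp
    simp only [hamiltonian, hlin, Finset.sum_add_distrib, ← Finset.smul_sum,
      Finset.sum_sub_distrib]
    rw [add_sub_add_right_eq_sub]
    abel

lemma one_mem_reachable (Hint : Operator κ) : 1 ∈ reachable Hint := by
  refine ⟨0, le_rfl, fun _ _ => 0, fun _ => 1, ⟨fun _ _ => Matrix.isHermitian_zero, ?_,
    continuousOn_const, ?_⟩, rfl⟩
  · intro j p q
    exact IntervalIntegrable.refl
  · intro t ht a b
    obtain rfl : t = 0 := le_antisymm ht.2 ht.1
    simp

open MeasureTheory in
lemma intervalIntegrable_hamiltonian_apply {Hint : Operator κ} {τ : ℝ} {h : ℝ → Fields κ}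
    (hh : ∀ j p q, IntervalIntegrable (fun s => h s j p q) volume 0 τ) (a b : ∀ j, κ j) :
    IntervalIntegrable (fun s => hamiltonian Hint (h s) a b) volume 0 τ := by
  simp only [hamiltonian, Matrix.add_apply, Matrix.sum_apply]
  refine IntervalIntegrable.add ?_ intervalIntegrable_const
  refine (IntervalIntegrable.sum Finset.univ (f := fun j s => onSite j (h s j) a b)
    fun j _ => ?_).congr ?_
  · unfold onSite
    split_ifs
    · exact hh j _ _
    · exact intervalIntegrable_const
  · intro s _
    simp

open MeasureTheory in
lemma IsPropagator.intervalIntegrable_mul_apply {Hint : Operator κ} {τ : ℝ} (hτ : 0 ≤ τ)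
    {h : ℝ → Fields κ} {Y : ℝ → Operator κ} (hY : IsPropagator Hint τ h Y) (a b : ∀ j, κ j) :
    IntervalIntegrable (fun s => (hamiltonian Hint (h s) * Y s) a b) volume 0 τ := by
  simp only [Matrix.mul_apply]
  refine (IntervalIntegrable.sum Finset.univ
    (f := fun k s => hamiltonian Hint (h s) a k * Y s k b) fun k _ => ?_).congr ?_
  · refine (intervalIntegrable_hamiltonian_apply hY.2.1 a k).mul_continuousOn ?_
    rw [Set.uIcc_of_le hτ]
    exact (continuous_apply_apply k b).comp_continuousOn hY.2.2.1
  · intro s _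
    simp

lemma IsPropagator.apply_zero {Hint : Operator κ} {τ : ℝ} (hτ : 0 ≤ τ) {h : ℝ → Fields κ}
    {Y : ℝ → Operator κ} (hY : IsPropagator Hint τ h Y) : Y 0 = 1 := by
  ext a b
  simpa using hY.2.2.2 0 ⟨le_rfl, hτ⟩ a b

open MeasureTheory in
/-- Running one trajectory of the fields after another composes the propagators. -/
lemma mul_mem_reachable {Hint : Operator κ} {U V : Matrix.unitaryGroup (∀ j, κ j) ℂ}
    (hU : U ∈ reachable Hint) (hV : V ∈ reachable Hint) : U * V ∈ reachable Hint := by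
  obtain ⟨τ₁, hτ₁, h₁, Y₁, hY₁, hV⟩ := hV
  obtain ⟨τ₂, hτ₂, h₂, Y₂, hY₂, hU⟩ := hU
  set h : ℝ → Fields κ := fun s => if s ≤ τ₁ then h₁ s else h₂ (s - τ₁) with hh
  set Y : ℝ → Operator κ := fun s => if s ≤ τ₁ then Y₁ s else Y₂ (s - τ₁) * V with hYdef
  have hh₁ : ∀ s ≤ τ₁, h s = h₁ s := fun s hs => if_pos hs
  have hh₂ : ∀ s, τ₁ < s → h s = h₂ (s - τ₁) := fun s hs => if_neg hs.not_ge
  have hYle : ∀ s ≤ τ₁, Y s = Y₁ s := fun s hs => if_pos hs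
  have hYge : ∀ s, τ₁ ≤ s → Y s = Y₂ (s - τ₁) * V := by
    intro s hs
    rcases hs.eq_or_lt with rfl | hs
    · rw [hYle _ le_rfl, hV, sub_self, hY₂.apply_zero hτ₂, Matrix.one_mul]
    · exact if_neg hs.not_ge
  have hcomp : ∀ {f : ℝ → ℂ} {t : ℝ}, IntervalIntegrable f volume 0 t →
      IntervalIntegrable (fun s => f (s - τ₁)) volume τ₁ (t + τ₁) := by
    intro f t hf
    simpa using hf.comp_sub_right τ₁
  have hcongr : ∀ {f g : ℝ → ℂ} {s t : ℝ}, Set.EqOn f g (Set.uIoc s t) →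
      ∫ x in s..t, f x = ∫ x in s..t, g x := fun hfg =>
    intervalIntegral.integral_congr_ae (Filter.Eventually.of_forall fun x hx => hfg hx)
  -- the integrand of the concatenated trajectory on the two pieces
  have hG₁ : ∀ a b t, t ≤ τ₁ → Set.EqOn (fun s => (hamiltonian Hint (h₁ s) * Y₁ s) a b)
      (fun s => (hamiltonian Hint (h s) * Y s) a b) (Set.uIoc 0 t) := by
    intro a b t ht s hs
    have hs' : s ≤ τ₁ := hs.2.trans (max_le hτ₁ ht)
    simp only [hh₁ s hs', hYle s hs']
  have hG₂ : ∀ a b t, τ₁ ≤ t → Set.EqOn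
      (fun s => ∑ k, (hamiltonian Hint (h₂ (s - τ₁)) * Y₂ (s - τ₁)) a k * (V : Operator κ) k b)
      (fun s => (hamiltonian Hint (h s) * Y s) a b) (Set.uIoc τ₁ t) := by
    intro a b t ht s hs
    rw [Set.uIoc_of_le ht] at hs
    simp only [hh₂ s hs.1, hYge s hs.1.le]
    rw [← Matrix.mul_assoc, Matrix.mul_apply]
  have hτ : τ₁ ≤ τ₂ + τ₁ := by linarith
  refine ⟨τ₂ + τ₁, by linarith, h, Y, ⟨?_, ?_, ?_, ?_⟩, ?_⟩
  · intro t j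
    by_cases ht : t ≤ τ₁
    · rw [hh₁ t ht]; exact hY₁.1 t j
    · rw [hh₂ t (not_le.mp ht)]; exact hY₂.1 _ j
  · intro j p q
    refine IntervalIntegrable.trans (b := τ₁) ((hY₁.2.1 j p q).congr ?_)
      ((hcomp (hY₂.2.1 j p q)).congr ?_)
    · intro s hs
      rw [Set.uIoc_of_le hτ₁] at hs
      simp only [hh₁ s hs.2]
    · intro s hs
      rw [Set.uIoc_of_le hτ] at hs
      simp only [hh₂ s hs.1]
  · rw [← Set.Icc_union_Icc_eq_Icc hτ₁ hτ]
    refine ContinuousOn.union_of_isClosed ?_ ?_ isClosed_Icc isClosed_Icc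
    · exact hY₁.2.2.1.congr fun s hs => hYle s hs.2
    · refine ContinuousOn.congr ?_ fun s hs => hYge s hs.1
      refine ContinuousOn.mul ?_ continuousOn_const
      refine hY₂.2.2.1.comp (by fun_prop) fun s hs => ⟨?_, ?_⟩
      · linarith [hs.1]
      · linarith [hs.2]
  · intro t ht a b
    rcases le_total t τ₁ with h1 | h1
    · rw [hYle t h1, hY₁.2.2.2 t ⟨ht.1, h1⟩ a b]
      congr 2
      exact hcongr (hG₁ a b t h1)
    · have hmem : t - τ₁ ∈ Set.Icc 0 τ₂ := ⟨by linarith, by linarith [ht.2]⟩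
      have hint₁ := hY₁.intervalIntegrable_mul_apply hτ₁ a b
      have hsub : ∀ k, IntervalIntegrable
          (fun s => (hamiltonian Hint (h₂ s) * Y₂ s) a k * (V : Operator κ) k b)
          volume 0 (t - τ₁) := fun k =>
        ((hY₂.intervalIntegrable_mul_apply hτ₂ a k).mono_set (by
          rw [Set.uIcc_of_le hτ₂, Set.uIcc_of_le hmem.1]
          exact Set.Icc_subset_Icc_right hmem.2)).mul_const _
      have hint₂ : IntervalIntegrable (fun s => ∑ k,
          (hamiltonian Hint (h₂ (s - τ₁)) * Y₂ (s - τ₁)) a k * (V : Operator κ) k b)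
          volume τ₁ t := by
        have := hcomp (IntervalIntegrable.sum Finset.univ fun k _ => hsub k)
        simpa using this
      have e₁ : ∫ s in (0 : ℝ)..τ₁, (hamiltonian Hint (h s) * Y s) a b =
          ∫ s in (0 : ℝ)..τ₁, (hamiltonian Hint (h₁ s) * Y₁ s) a b :=
        (hcongr (hG₁ a b τ₁ le_rfl)).symm
      have e₂ : ∫ s in τ₁..t, (hamiltonian Hint (h s) * Y s) a b =
          ∑ k, (∫ s in (0 : ℝ)..(t - τ₁), (hamiltonian Hint (h₂ s) * Y₂ s) a k) *
            (V : Operator κ) k b := by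
        rw [← hcongr (hG₂ a b t h1),
          intervalIntegral.integral_comp_sub_right (fun s => ∑ k,
            (hamiltonian Hint (h₂ s) * Y₂ s) a k * (V : Operator κ) k b) τ₁, sub_self,
          intervalIntegral.integral_finsetSum fun k _ => hsub k]
        exact Finset.sum_congr rfl fun k _ => intervalIntegral.integral_mul_const _ _
      rw [← intervalIntegral.integral_add_adjacent_intervals
        (hint₁.congr (hG₁ a b τ₁ le_rfl)) (hint₂.congr (hG₂ a b t h1)), e₁, e₂, mul_add,
        ← sub_sub, ← hY₁.2.2.2 τ₁ ⟨hτ₁, le_rfl⟩ a b, hV, hYge t h1, Matrix.mul_apply]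
      simp only [hY₂.2.2.2 (t - τ₁) hmem, sub_mul, Finset.sum_sub_distrib]
      rw [← Matrix.mul_apply, Matrix.one_mul, Finset.mul_sum]
      simp only [mul_assoc]
  · rw [hYge _ hτ, add_sub_cancel_right, hU]
    rfl

end Control

/-! ### Minimal dissipation -/

section MinDissipation

variable {ι : Type*} [Fintype ι] [DecidableEq ι]
  {κ : ι → Type*} [∀ j, Fintype (κ j)] [∀ j, DecidableEq (κ j)] [∀ j, Nonempty (κ j)]

lemma dissipation_nonneg (U : Matrix.unitaryGroup (∀ j, κ j) ℂ) (T T' : ℝ) {H H' : Operator κ}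
    (hH : H.IsHermitian) (hH' : H'.IsHermitian) : 0 ≤ dissipation U T H T' H' :=
  relEntropy_gibbs_nonneg T' ((isState_gibbs T hH).conjugate U) hH'

lemma minDissipation_nonneg (Hint : Operator κ) (T T' : ℝ) {H H' : Operator κ}
    (hH : H.IsHermitian) (hH' : H'.IsHermitian) : 0 ≤ minDissipation Hint T H T' H' :=
  Real.iInf_nonneg fun U => dissipation_nonneg U.1 T T' hH hH'

lemma minDissipation_le {Hint : Operator κ} {U : Matrix.unitaryGroup (∀ j, κ j) ℂ}
    (hU : U ∈ reachable Hint) (T T' : ℝ) {H H' : Operator κ}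
    (hH : H.IsHermitian) (hH' : H'.IsHermitian) :
    minDissipation Hint T H T' H' ≤ dissipation U T H T' H' :=
  ciInf_le (f := fun U : reachable Hint => dissipation U.1 T H T' H')
    ⟨0, by rintro _ ⟨V, rfl⟩; exact dissipation_nonneg V.1 T T' hH hH'⟩ ⟨U, hU⟩

lemma exists_dissipation_lt (Hint : Operator κ) (T T' : ℝ) (H H' : Operator κ) {r : ℝ}
    (hr : minDissipation Hint T H T' H' < r) :
    ∃ U ∈ reachable Hint, dissipation U T H T' H' < r := by
  have : Nonempty (reachable Hint) := ⟨⟨1, one_mem_reachable Hint⟩⟩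
  obtain ⟨U, hU⟩ := exists_lt_of_ciInf_lt hr
  exact ⟨U.1, U.2, hU⟩

end MinDissipation

/-! ### The two laws of thermodynamics for a cycle -/

lemma sum_range_add_of_periodic {f : ℕ → ℝ} {N : ℕ} (hf : ∀ i, f (i + N) = f i) (a : ℕ) :
    ∑ i ∈ Finset.range N, f (a + i) = ∑ i ∈ Finset.range N, f i := by
  induction a with
  | zero => simp
  | succ a ih =>
    have h := Finset.sum_range_succ' (fun i => f (a + i)) N
    rw [Finset.sum_range_succ, hf, add_zero, add_left_inj] at h
    rw [← ih, h]
    exact Finset.sum_congr rfl fun i _ => by rw [add_right_comm, add_assoc]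

namespace Cycle

variable {ι : Type*} [Fintype ι] [DecidableEq ι]
  {κ : ι → Type*} [∀ j, Fintype (κ j)] [∀ j, DecidableEq (κ j)]
  {Hint : Operator κ} {Th Tc : ℝ}

/-- The entropy before operation `i`. -/
noncomputable def entropyAt (P : Cycle Hint Th Tc) (i : ℕ) : ℝ := entropy (P.state i)

/-- The entropy that operation `i` draws from the hot bath: the heat from that bath over `Th`. -/
noncomputable def entropyHot (P : Cycle Hint Th Tc) (i : ℕ) : ℝ :=
  match P.op i with
  | .contact .hot => Th⁻¹ * (P.energyAt (i + 1) - P.energyAt i)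
  | _ => 0

/-- The entropy that operation `i` draws from the cold bath: the heat from that bath over `Tc`. -/
noncomputable def entropyCold (P : Cycle Hint Th Tc) (i : ℕ) : ℝ :=
  match P.op i with
  | .contact .cold => Tc⁻¹ * (P.energyAt (i + 1) - P.energyAt i)
  | _ => 0

lemma entropyHot_of_evolution (P : Cycle Hint Th Tc) {i : ℕ}
    {U : Matrix.unitaryGroup (∀ j, κ j) ℂ} (h : P.op i = .evolution U) : P.entropyHot i = 0 := by
  simp [entropyHot, h]

lemma entropyCold_of_evolution (P : Cycle Hint Th Tc) {i : ℕ}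
    {U : Matrix.unitaryGroup (∀ j, κ j) ℂ} (h : P.op i = .evolution U) : P.entropyCold i = 0 := by
  simp [entropyCold, h]

lemma entropyHot_of_cold (P : Cycle Hint Th Tc) {i : ℕ} (h : P.op i = .contact .cold) :
    P.entropyHot i = 0 := by
  simp [entropyHot, h]

lemma entropyCold_of_hot (P : Cycle Hint Th Tc) {i : ℕ} (h : P.op i = .contact .hot) :
    P.entropyCold i = 0 := by
  simp [entropyCold, h]

lemma state_succ_of_contact (P : Cycle Hint Th Tc) {i : ℕ} {b : Bath}
    (h : P.op i = .contact b) : P.state (i + 1) = gibbs (b.temp Th Tc) (P.ham i) := by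
  have := P.effect i
  rw [h] at this
  exact this.1

lemma ham_succ_of_contact (P : Cycle Hint Th Tc) {i : ℕ} {b : Bath}
    (h : P.op i = .contact b) : P.ham (i + 1) = P.ham i := by
  have := P.effect i
  rw [h] at this
  exact this.2

lemma reachable_of_evolution (P : Cycle Hint Th Tc) {i : ℕ}
    {U : Matrix.unitaryGroup (∀ j, κ j) ℂ} (h : P.op i = .evolution U) : U ∈ reachable Hint := by
  have := P.effect i
  rw [h] at this
  exact this.1

lemma state_succ_of_evolution (P : Cycle Hint Th Tc) {i : ℕ}
    {U : Matrix.unitaryGroup (∀ j, κ j) ℂ} (h : P.op i = .evolution U) :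
    P.state (i + 1) = conjugate U (P.state i) := by
  have := P.effect i
  rw [h] at this
  exact this.2

lemma entropyAt_succ_of_evolution (P : Cycle Hint Th Tc) {i : ℕ}
    {U : Matrix.unitaryGroup (∀ j, κ j) ℂ} (h : P.op i = .evolution U) :
    P.entropyAt (i + 1) = P.entropyAt i := by
  rw [entropyAt, P.state_succ_of_evolution h, entropy_conjugate (P.isState i).1.isHermitian]
  rfl

lemma heatHot_eq (P : Cycle Hint Th Tc) (hTh : Th ≠ 0) :
    P.heatHot = Th * ∑ i ∈ Finset.range P.period, P.entropyHot i := by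
  rw [heatHot, Finset.mul_sum]
  refine Finset.sum_congr rfl fun i _ => ?_
  rw [entropyHot]
  rcases P.op i with U | (_ | _) <;> simp [hTh]

lemma sum_range_succ_sub_eq_zero (P : Cycle Hint Th Tc) {f : ℕ → ℝ}
    (hf : ∀ i, f (i + P.period) = f i) : ∑ i ∈ Finset.range P.period, (f (i + 1) - f i) = 0 := by
  have h := hf 0
  rw [zero_add] at h
  rw [Finset.sum_range_sub, h, sub_self]

lemma energyAt_periodic (P : Cycle Hint Th Tc) (i : ℕ) :
    P.energyAt (i + P.period) = P.energyAt i := by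
  rw [energyAt, P.state_periodic, P.ham_periodic]; rfl

lemma entropyAt_periodic (P : Cycle Hint Th Tc) (i : ℕ) :
    P.entropyAt (i + P.period) = P.entropyAt i := by
  rw [entropyAt, P.state_periodic]; rfl

lemma entropyHot_periodic (P : Cycle Hint Th Tc) (i : ℕ) :
    P.entropyHot (i + P.period) = P.entropyHot i := by
  rw [entropyHot, P.op_periodic, add_right_comm, P.energyAt_periodic, P.energyAt_periodic]; rfl

lemma entropyCold_periodic (P : Cycle Hint Th Tc) (i : ℕ) :
    P.entropyCold (i + P.period) = P.entropyCold i := by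
  rw [entropyCold, P.op_periodic, add_right_comm, P.energyAt_periodic, P.energyAt_periodic]; rfl

/-- The first law: the work is the total heat. -/
lemma work_eq (P : Cycle Hint Th Tc) (hTh : Th ≠ 0) (hTc : Tc ≠ 0) :
    P.work = Th * ∑ i ∈ Finset.range P.period, P.entropyHot i +
      Tc * ∑ i ∈ Finset.range P.period, P.entropyCold i := by
  have h := P.sum_range_succ_sub_eq_zero P.energyAt_periodic
  rw [work, Finset.mul_sum, Finset.mul_sum, ← Finset.sum_add_distrib, ← sub_eq_zero,
    ← neg_eq_zero, ← h, ← Finset.sum_sub_distrib, ← Finset.sum_neg_distrib]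
  refine Finset.sum_congr rfl fun i _ => ?_
  rw [entropyHot, entropyCold]
  rcases P.op i with U | (_ | _) <;> simp [hTh, hTc, -Finset.sum_sub_distrib, h]

variable [∀ j, Nonempty (κ j)]

lemma isHermitian_ham (P : Cycle Hint Th Tc) (hHint : Hint.IsHermitian) (i : ℕ) :
    (P.ham i).IsHermitian :=
  (P.isAdmissible i).isHermitian hHint

/-- The second law for a single contact. -/
lemma mul_heat_of_contact (P : Cycle Hint Th Tc) (hHint : Hint.IsHermitian) {i : ℕ} {b : Bath}
    (h : P.op i = .contact b) :
    (b.temp Th Tc)⁻¹ * (P.energyAt (i + 1) - P.energyAt i) = P.entropyAt (i + 1) -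
      P.entropyAt i - relEntropy (P.state i) (gibbs (b.temp Th Tc) (P.ham i)) := by
  rw [relEntropy_gibbs _ (P.isState i) (P.isHermitian_ham hHint i), energyAt, energyAt, entropyAt,
    entropyAt, P.state_succ_of_contact h, P.ham_succ_of_contact h]
  ring

lemma entropyHot_of_hot (P : Cycle Hint Th Tc) (hHint : Hint.IsHermitian) {i : ℕ}
    (h : P.op i = .contact .hot) :
    P.entropyHot i = P.entropyAt (i + 1) - P.entropyAt i -
      relEntropy (P.state i) (gibbs Th (P.ham i)) := by
  rw [entropyHot, h]
  exact P.mul_heat_of_contact hHint h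

lemma entropyCold_of_cold (P : Cycle Hint Th Tc) (hHint : Hint.IsHermitian) {i : ℕ}
    (h : P.op i = .contact .cold) :
    P.entropyCold i = P.entropyAt (i + 1) - P.entropyAt i -
      relEntropy (P.state i) (gibbs Tc (P.ham i)) := by
  rw [entropyCold, h]
  exact P.mul_heat_of_contact hHint h

lemma entropyHot_add_entropyCold_le (P : Cycle Hint Th Tc) (hHint : Hint.IsHermitian) (i : ℕ) :
    P.entropyHot i + P.entropyCold i ≤ P.entropyAt (i + 1) - P.entropyAt i := by
  rcases h : P.op i with U | (_ | _)
  · rw [P.entropyHot_of_evolution h, P.entropyCold_of_evolution h,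
      P.entropyAt_succ_of_evolution h]
    simp
  · have := relEntropy_gibbs_nonneg Th (P.isState i) (P.isHermitian_ham hHint i)
    rw [P.entropyCold_of_hot h, P.entropyHot_of_hot hHint h]
    linarith
  · have := relEntropy_gibbs_nonneg Tc (P.isState i) (P.isHermitian_ham hHint i)
    rw [P.entropyHot_of_cold h, P.entropyCold_of_cold hHint h]
    linarith

/-- The second law, in the form of Clausius. -/
lemma sum_entropyHot_add_sum_entropyCold_nonpos (P : Cycle Hint Th Tc)
    (hHint : Hint.IsHermitian) :
    ∑ i ∈ Finset.range P.period, P.entropyHot i +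
      ∑ i ∈ Finset.range P.period, P.entropyCold i ≤ 0 := by
  rw [← Finset.sum_add_distrib, ← P.sum_range_succ_sub_eq_zero P.entropyAt_periodic]
  exact Finset.sum_le_sum fun i _ => P.entropyHot_add_entropyCold_le hHint i

/-! ### Hot runs and the bound on the efficiency -/

/-- Between contacts the state evolves by a single reachable unitary. -/
lemma exists_reachable_conjugate (P : Cycle Hint Th Tc) {d n : ℕ} (hdn : d < n)
    (h : ∀ i, d < i → i < n → ∀ x, P.op i ≠ .contact x) :
    ∃ U ∈ reachable Hint, P.state n = conjugate U (P.state (d + 1)) := by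
  induction n, hdn using Nat.le_induction with
  | base => exact ⟨1, one_mem_reachable Hint, (conjugate_one _).symm⟩
  | succ n hn ih =>
    obtain ⟨U, hU, hs⟩ := ih fun i hi hin => h i hi (Nat.lt_succ_of_lt hin)
    rcases hop : P.op n with V | x
    · refine ⟨V * U, mul_mem_reachable (P.reachable_of_evolution hop) hU, ?_⟩
      rw [P.state_succ_of_evolution hop, hs, conjugate_mul]
    · exact absurd hop (h n hn (Nat.lt_succ_self n) x)

lemma entropyAt_eq_of_no_contact (P : Cycle Hint Th Tc) {d n : ℕ} (hdn : d < n)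
    (h : ∀ i, d < i → i < n → ∀ x, P.op i ≠ .contact x) :
    P.entropyAt n = P.entropyAt (d + 1) := by
  obtain ⟨U, -, hs⟩ := P.exists_reachable_conjugate hdn h
  rw [entropyAt, hs, entropy_conjugate (P.isState _).1.isHermitian]
  rfl

/-- The entropy produced in the contact that follows a contact `d` is at least the minimal
dissipation between the two Hamiltonians. -/
lemma minDissipation_le_relEntropy (P : Cycle Hint Th Tc) (hHint : Hint.IsHermitian) {d a : ℕ}
    {x : Bath} (hda : d < a) (hd : P.op d = .contact x)
    (h : ∀ i, d < i → i < a → ∀ x, P.op i ≠ .contact x) (T' : ℝ) :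
    minDissipation Hint (x.temp Th Tc) (P.ham d) T' (P.ham a) ≤
      relEntropy (P.state a) (gibbs T' (P.ham a)) := by
  obtain ⟨U, hU, hs⟩ := P.exists_reachable_conjugate hda h
  rw [hs, P.state_succ_of_contact hd]
  exact minDissipation_le hU _ _ (P.isHermitian_ham hHint d) (P.isHermitian_ham hHint a)

/-- The invariant of the induction in time, at a time `n` whose last contact was cold. The
sums run over the operations after the cold contact `s`. -/
def ColdPhase (P : Cycle Hint Th Tc) (k : ℝ) (s n : ℕ) : Prop :=
  ∃ d, d < n ∧ P.op d = .contact .cold ∧ (∀ i, d < i → i < n → ∀ x, P.op i ≠ .contact x) ∧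
    ∑ i ∈ Finset.Ico (s + 1) n, (k * P.entropyHot i + P.entropyCold i) ≤
      P.entropyAt (d + 1) - P.entropyAt (s + 1) ∧
    (0 < ∑ i ∈ Finset.Ico (s + 1) n, P.entropyHot i →
      ∑ i ∈ Finset.Ico (s + 1) n, (k * P.entropyHot i + P.entropyCold i) <
        P.entropyAt (d + 1) - P.entropyAt (s + 1))

/-- The quantity `ΔS^{B,D} - min D` of a hot run that begins at the contact `a`, has its last
contact so far at `b`, and is preceded by the cold contact `d`. -/
noncomputable def gain (P : Cycle Hint Th Tc) (a b d : ℕ) : ℝ :=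
  P.entropyAt (b + 1) - P.entropyAt (d + 1) - minDissipation Hint Tc (P.ham d) Th (P.ham a)

/-- The invariant of the induction in time, at a time `n` whose last contact was hot. -/
def HotPhase (P : Cycle Hint Th Tc) (k : ℝ) (s n : ℕ) : Prop :=
  ∃ a b d, d < a ∧ a ≤ b ∧ b < n ∧ P.op d = .contact .cold ∧ P.op a = .contact .hot ∧
    P.op b = .contact .hot ∧ (∀ i, d < i → i < a → ∀ x, P.op i ≠ .contact x) ∧
    (∀ i, a < i → i < b → P.op i ≠ .contact .cold) ∧
    (∀ i, b < i → i < n → ∀ x, P.op i ≠ .contact x) ∧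
    ∑ i ∈ Finset.Ico (s + 1) n, (k * P.entropyHot i + P.entropyCold i) ≤
      P.entropyAt (d + 1) - P.entropyAt (s + 1) + k * P.gain a b d ∧
    (P.gain a b d < ∑ i ∈ Finset.Ico (s + 1) n, P.entropyHot i →
      ∑ i ∈ Finset.Ico (s + 1) n, (k * P.entropyHot i + P.entropyCold i) <
        P.entropyAt (d + 1) - P.entropyAt (s + 1) + k * P.gain a b d)

lemma coldPhase_or_hotPhase (P : Cycle Hint Th Tc) (hHint : Hint.IsHermitian) {k : ℝ}
    (hk : 1 ≤ k)
    (hrun : ∀ a b c d, P.IsHotRun a b c d → 0 < P.gain a b d →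
      k * P.gain a b d < P.entropyAt (b + 1) - P.entropyAt (d + 1) +
        minDissipation Hint Th (P.ham b) Tc (P.ham c))
    {s : ℕ} (hs : P.op s = .contact .cold) {n : ℕ} (hn : s < n) :
    P.ColdPhase k s n ∨ P.HotPhase k s n := by
  induction n, hn using Nat.le_induction with
  | base =>
    refine Or.inl ⟨s, Nat.lt_succ_self s, hs, fun i hi hi' => by omega, ?_, ?_⟩ <;> simp
  | succ n hn ih =>
    have hext : ∀ {e : ℕ} {U : Matrix.unitaryGroup (∀ j, κ j) ℂ}, P.op n = .evolution U →
        (∀ i, e < i → i < n → ∀ x, P.op i ≠ .contact x) →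
        ∀ i, e < i → i < n + 1 → ∀ x, P.op i ≠ .contact x := by
      intro e U hU he i hi hi' x
      rcases Nat.lt_succ_iff_lt_or_eq.mp hi' with h | rfl
      · exact he i hi h x
      · rw [hU]; simp
    have hG := Finset.sum_Ico_succ_top hn fun i => k * P.entropyHot i + P.entropyCold i
    have hX := Finset.sum_Ico_succ_top hn P.entropyHot
    set G := ∑ i ∈ Finset.Ico (s + 1) n, (k * P.entropyHot i + P.entropyCold i)
    set X := ∑ i ∈ Finset.Ico (s + 1) n, P.entropyHot i
    rcases ih with ⟨d, hdn, hd, hfree, hle, hlt⟩ |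
      ⟨a, b, d, hda, hab, hbn, hd, ha, hb, hfda, hfab, hfree, hle, hlt⟩
    · have hS := P.entropyAt_eq_of_no_contact hdn hfree
      rcases hop : P.op n with U | (_ | _)
      · rw [P.entropyHot_of_evolution hop, P.entropyCold_of_evolution hop] at hG
        rw [P.entropyHot_of_evolution hop] at hX
        left
        refine ⟨d, hdn.trans (Nat.lt_succ_self n), hd, hext hop hfree, ?_, ?_⟩
        · linarith
        · intro h
          have := hlt (by linarith)
          linarith
      · rw [P.entropyHot_of_hot hHint hop, P.entropyCold_of_hot hop] at hG
        rw [P.entropyHot_of_hot hHint hop] at hX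
        have hD := P.minDissipation_le_relEntropy hHint hdn hd hfree Th
        have hkD := mul_le_mul_of_nonneg_left hD (zero_le_one.trans hk)
        right
        refine ⟨n, n, d, hdn, le_rfl, Nat.lt_succ_self n, hd, hop, hop, hfree,
          fun i h h' => by omega, fun i h h' => by omega, ?_, ?_⟩
        · rw [hG, gain, hS]
          simp only [Bath.temp] at hkD
          linarith
        · intro h
          simp only [Bath.temp] at hkD hD
          rw [gain] at h
          have := hlt (by linarith)
          rw [hG, gain, hS]
          linarith
      · rw [P.entropyHot_of_cold hop, P.entropyCold_of_cold hHint hop] at hG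
        rw [P.entropyHot_of_cold hop] at hX
        have hD := relEntropy_gibbs_nonneg Tc (P.isState n) (P.isHermitian_ham hHint n)
        left
        refine ⟨n, Nat.lt_succ_self n, hop, fun i h h' => by omega, ?_, ?_⟩
        · linarith
        · intro h
          have := hlt (by linarith)
          linarith
    · have hS := P.entropyAt_eq_of_no_contact hbn hfree
      rcases hop : P.op n with U | (_ | _)
      · rw [P.entropyHot_of_evolution hop, P.entropyCold_of_evolution hop] at hG
        rw [P.entropyHot_of_evolution hop] at hX
        right
        refine ⟨a, b, d, hda, hab, hbn.trans (Nat.lt_succ_self n), hd, ha, hb, hfda, hfab,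
          hext hop hfree, ?_, ?_⟩
        · linarith
        · intro h
          have := hlt (by linarith)
          linarith
      · rw [P.entropyHot_of_hot hHint hop, P.entropyCold_of_hot hop] at hG
        rw [P.entropyHot_of_hot hHint hop] at hX
        have hD := relEntropy_gibbs_nonneg Th (P.isState n) (P.isHermitian_ham hHint n)
        have hkD := mul_nonneg (zero_le_one.trans hk) hD
        have hgain : P.gain a n d = P.gain a b d + (P.entropyAt (n + 1) - P.entropyAt n) := by
          rw [gain, gain, hS]; ring
        right
        refine ⟨a, n, d, hda, hab.trans hbn.le, Nat.lt_succ_self n, hd, ha, hop, hfda, ?_,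
          fun i h h' => by omega, ?_, ?_⟩
        · intro i hi hin
          rcases lt_trichotomy i b with h | rfl | h
          · exact hfab i hi h
          · rw [hb]; simp
          · exact hfree i h hin _
        · rw [hG, hgain]
          linarith
        · intro h
          rw [hgain] at h
          have := hlt (by linarith)
          rw [hG, hgain]
          linarith
      · rw [P.entropyHot_of_cold hop, P.entropyCold_of_cold hHint hop] at hG
        rw [P.entropyHot_of_cold hop] at hX
        have hD := P.minDissipation_le_relEntropy hHint hbn hb hfree Tc
        simp only [Bath.temp] at hD
        have hr := hrun a b n d ⟨hda, hab, hbn, hd, ha, hb, hop, hfda, hfab, hfree⟩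
        have hm := minDissipation_nonneg Hint Tc Th (P.isHermitian_ham hHint d)
          (P.isHermitian_ham hHint a)
        have hm' := minDissipation_nonneg Hint Th Tc (P.isHermitian_ham hHint b)
          (P.isHermitian_ham hHint n)
        -- a run without gain costs at least its gain, hence at least `k ≥ 1` times its gain
        have hr' : k * P.gain a b d ≤ P.entropyAt (b + 1) - P.entropyAt (d + 1) +
            minDissipation Hint Th (P.ham b) Tc (P.ham n) := by
          rcases lt_or_ge 0 (P.gain a b d) with h | h
          · exact (hr h).le
          · have h1 : k * P.gain a b d ≤ P.gain a b d := by nlinarith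
            have h2 : P.gain a b d ≤ P.entropyAt (b + 1) - P.entropyAt (d + 1) := by
              rw [gain]; linarith
            linarith
        left
        refine ⟨n, Nat.lt_succ_self n, hop, fun i h h' => by omega, ?_, ?_⟩
        · linarith
        · intro h
          rcases lt_or_ge (P.gain a b d) X with h1 | h1
          · have := hlt h1
            linarith
          · have := hr (by linarith)
            linarith

/-- If the hot bath provides heat, then some hot run is at least as efficient as the cycle: its
ratio of cost to gain is at most `k`, the ratio of the entropy delivered to the cold bath to the
entropy drawn from the hot bath. -/
lemma exists_isHotRun (P : Cycle Hint Th Tc) (hHint : Hint.IsHermitian)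
    (hpos : 0 < ∑ i ∈ Finset.range P.period, P.entropyHot i) {k : ℝ}
    (hk : k * ∑ i ∈ Finset.range P.period, P.entropyHot i =
      -∑ i ∈ Finset.range P.period, P.entropyCold i) :
    ∃ a b c d, P.IsHotRun a b c d ∧ 0 < P.gain a b d ∧
      P.entropyAt (b + 1) - P.entropyAt (d + 1) +
        minDissipation Hint Th (P.ham b) Tc (P.ham c) ≤ k * P.gain a b d := by
  by_contra! hcon
  have hsecond := P.sum_entropyHot_add_sum_entropyCold_nonpos hHint
  have hk1 : 1 ≤ k := by
    by_contra! h
    nlinarith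
  obtain ⟨s, hs⟩ : ∃ s, P.op s = .contact .cold := by
    by_contra! h
    have : ∑ i ∈ Finset.range P.period, P.entropyCold i = 0 :=
      Finset.sum_eq_zero fun i _ => by
        rcases hop : P.op i with U | (_ | _)
        · exact P.entropyCold_of_evolution hop
        · exact P.entropyCold_of_hot hop
        · exact absurd hop (h i)
    linarith
  have hsum : ∀ f : ℕ → ℝ, (∀ i, f (i + P.period) = f i) →
      ∑ i ∈ Finset.Ico (s + 1) (s + P.period + 1), f i = ∑ i ∈ Finset.range P.period, f i := by
    intro f hf
    rw [add_right_comm, Finset.sum_Ico_eq_sum_range, Nat.add_sub_cancel_left]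
    exact sum_range_add_of_periodic hf (s + 1)
  have hlast : P.op (s + P.period) = .contact .cold := by rw [P.op_periodic, hs]
  have hper := P.period_pos
  rcases P.coldPhase_or_hotPhase hHint hk1 hcon hs (n := s + P.period + 1) (by omega) with
    ⟨d, hdn, -, hfree, -, hlt⟩ | ⟨a, b, d, -, -, hbn, -, -, hb, -, -, hfree, -, -⟩
  · obtain rfl : d = s + P.period := by
      by_contra hne
      exact hfree _ (by omega) (by omega) _ hlast
    rw [hsum _ P.entropyHot_periodic, hsum _ fun i => by
      rw [P.entropyHot_periodic, P.entropyCold_periodic], Finset.sum_add_distrib,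
      ← Finset.mul_sum, hk, add_right_comm, P.entropyAt_periodic] at hlt
    have := hlt hpos
    simp at this
  · rcases Nat.lt_succ_iff_lt_or_eq.mp hbn with h | rfl
    · exact hfree _ h (by omega) _ hlast
    · rw [hlast] at hb
      simp at hb

end Cycle

/-! ### Slow isothermals -/

section Isothermal

variable {ι : Type*} [Fintype ι] [DecidableEq ι]
  {κ : ι → Type*} [∀ j, Fintype (κ j)] [∀ j, DecidableEq (κ j)]

/-- The `j`-th of the Hamiltonians of an isothermal from `A` to `B` in `m` steps. -/
noncomputable def isothermalHam (A B : Operator κ) (m j : ℕ) : Operator κ :=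
  A + ((j : ℂ) / (m : ℂ)) • (B - A)

lemma isothermalHam_zero (A B : Operator κ) (m : ℕ) : isothermalHam A B m 0 = A := by
  simp [isothermalHam]

lemma isothermalHam_self (A B : Operator κ) {m : ℕ} (hm : m ≠ 0) :
    isothermalHam A B m m = B := by
  have : (m : ℂ) ≠ 0 := Nat.cast_ne_zero.mpr hm
  simp [isothermalHam, this]

lemma isAdmissible_isothermalHam {Hint A B : Operator κ} (hA : IsAdmissible Hint A)
    (hB : IsAdmissible Hint B) (m j : ℕ) : IsAdmissible Hint (isothermalHam A B m j) := by
  have := hA.add_smul_sub hB ((j : ℝ) / (m : ℝ))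
  push_cast at this
  exact this

lemma isothermalHam_succ_sub (A B : Operator κ) (m j : ℕ) :
    isothermalHam A B m (j + 1) - isothermalHam A B m j = (((m : ℝ)⁻¹ : ℝ) : ℂ) • (B - A) := by
  rw [isothermalHam, isothermalHam, add_sub_add_left_eq_sub, ← sub_smul]
  congr 1
  push_cast
  ring

/-- The entropy produced by the quenches of an isothermal in `m` steps. -/
noncomputable def isothermalLoss (T : ℝ) (A B : Operator κ) (m : ℕ) : ℝ :=
  ∑ j ∈ Finset.range m,
    relEntropy (gibbs T (isothermalHam A B m j)) (gibbs T (isothermalHam A B m (j + 1)))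

lemma energy_smul (c : ℝ) (ρ H : Operator κ) : energy ρ ((c : ℂ) • H) = c * energy ρ H := by
  simp [energy]

variable [∀ j, Nonempty (κ j)]

lemma isothermalLoss_nonneg {Hint A B : Operator κ} (hHint : Hint.IsHermitian)
    (hA : IsAdmissible Hint A) (hB : IsAdmissible Hint B) (T : ℝ) (m : ℕ) :
    0 ≤ isothermalLoss T A B m :=
  Finset.sum_nonneg fun j _ => relEntropy_gibbs_nonneg T
    (isState_gibbs T ((isAdmissible_isothermalHam hA hB m j).isHermitian hHint))
    ((isAdmissible_isothermalHam hA hB m (j + 1)).isHermitian hHint)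

/-- Each term is at most the symmetrized relative entropy, and those telescope. -/
lemma isothermalLoss_le {Hint A B : Operator κ} (hHint : Hint.IsHermitian)
    (hA : IsAdmissible Hint A) (hB : IsAdmissible Hint B) (T : ℝ) {m : ℕ} (hm : m ≠ 0) :
    isothermalLoss T A B m ≤
      T⁻¹ * (energy (gibbs T A) (B - A) - energy (gibbs T B) (B - A)) * (m : ℝ)⁻¹ := by
  have hH : ∀ j, (isothermalHam A B m j).IsHermitian := fun j =>
    (isAdmissible_isothermalHam hA hB m j).isHermitian hHint
  set e : ℕ → ℝ := fun j => energy (gibbs T (isothermalHam A B m j)) (B - A) with he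
  have hstep : ∀ j, relEntropy (gibbs T (isothermalHam A B m j))
      (gibbs T (isothermalHam A B m (j + 1))) ≤ T⁻¹ * (m : ℝ)⁻¹ * (e j - e (j + 1)) := by
    intro j
    have h := relEntropy_gibbs_add_relEntropy_gibbs T (hH j) (hH (j + 1))
    rw [isothermalHam_succ_sub, energy_smul, energy_smul] at h
    have h' := relEntropy_gibbs_nonneg T (isState_gibbs T (hH (j + 1))) (hH j)
    simp only [he]
    linarith
  calc isothermalLoss T A B m
      ≤ ∑ j ∈ Finset.range m, T⁻¹ * (m : ℝ)⁻¹ * (e j - e (j + 1)) :=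
        Finset.sum_le_sum fun j _ => hstep j
    _ = T⁻¹ * (m : ℝ)⁻¹ * (e 0 - e m) := by rw [← Finset.mul_sum, Finset.sum_range_sub']
    _ = _ := by
        simp only [he]
        rw [isothermalHam_zero, isothermalHam_self A B hm]
        ring

open Filter Topology in
lemma tendsto_isothermalLoss {Hint A B : Operator κ} (hHint : Hint.IsHermitian)
    (hA : IsAdmissible Hint A) (hB : IsAdmissible Hint B) (T : ℝ) :
    Tendsto (fun m => isothermalLoss T A B m) atTop (𝓝 0) := by
  have h := (tendsto_inv_atTop_nhds_zero_nat (𝕜 := ℝ)).const_mul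
    (T⁻¹ * (energy (gibbs T A) (B - A) - energy (gibbs T B) (B - A)))
  rw [mul_zero] at h
  refine tendsto_of_tendsto_of_tendsto_of_le_of_le' tendsto_const_nhds h
    (Eventually.of_forall fun m => isothermalLoss_nonneg hHint hA hB T m) ?_
  filter_upwards [eventually_ne_atTop 0] with m hm
  exact isothermalLoss_le hHint hA hB T hm

end Isothermal

/-! ### The entropy balance of a Carnot-like protocol -/

lemma sum_range_two_mul (f : ℕ → ℝ) (n : ℕ) :
    ∑ i ∈ Finset.range (2 * n), f i = ∑ k ∈ Finset.range n, (f (2 * k) + f (2 * k + 1)) := by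
  induction n with
  | zero => simp
  | succ n ih =>
    rw [Nat.mul_succ, Finset.sum_range_succ, Finset.sum_range_succ, ih, Finset.sum_range_succ]
    ring

namespace Cycle

variable {ι : Type*} [Fintype ι] [DecidableEq ι]
  {κ : ι → Type*} [∀ j, Fintype (κ j)] [∀ j, DecidableEq (κ j)] [∀ j, Nonempty (κ j)]
  {Hint : Operator κ} {Th Tc : ℝ}

/-- The entropy drawn from bath `x` by an evolution `U` followed by an isothermal. -/
lemma sum_heat_isothermal (P : Cycle Hint Th Tc) (hHint : Hint.IsHermitian) {x : Bath}
    {A B : Operator κ} {U : Matrix.unitaryGroup (∀ j, κ j) ℂ} {m e : ℕ}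
    (hU : P.op (2 * e) = .evolution U)
    (hcontact : ∀ j ≤ m, P.op (2 * (e + j) + 1) = .contact x ∧
      P.ham (2 * (e + j) + 1) = isothermalHam A B m j)
    (hquench : ∀ j, 1 ≤ j → j ≤ m → P.op (2 * (e + j)) = .evolution 1) {l : ℕ} (hl : l ≤ m) :
    ∑ j ∈ Finset.range (l + 1), (x.temp Th Tc)⁻¹ *
        (P.energyAt (2 * (e + j) + 1 + 1) - P.energyAt (2 * (e + j) + 1)) =
      entropy (gibbs (x.temp Th Tc) (isothermalHam A B m l)) - P.entropyAt (2 * e) -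
        relEntropy (conjugate U (P.state (2 * e)))
          (gibbs (x.temp Th Tc) (isothermalHam A B m 0)) -
        ∑ j ∈ Finset.range l, relEntropy (gibbs (x.temp Th Tc) (isothermalHam A B m j))
          (gibbs (x.temp Th Tc) (isothermalHam A B m (j + 1))) := by
  have hstate : ∀ j ≤ m, P.state (2 * (e + j) + 1 + 1) =
      gibbs (x.temp Th Tc) (isothermalHam A B m j) := by
    intro j hj
    rw [P.state_succ_of_contact (hcontact j hj).1, (hcontact j hj).2]
  induction l with
  | zero =>
    obtain ⟨h1, h2⟩ := hcontact 0 (Nat.zero_le m)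
    have h3 := hstate 0 (Nat.zero_le m)
    rw [add_zero] at h1 h2 h3
    rw [zero_add, Finset.sum_range_one, Finset.sum_range_zero, sub_zero, add_zero,
      P.mul_heat_of_contact hHint h1, h2, P.entropyAt_succ_of_evolution hU,
      P.state_succ_of_evolution hU, entropyAt, h3]
  | succ l ih =>
    obtain ⟨h1, h2⟩ := hcontact (l + 1) hl
    have hop := hquench (l + 1) (Nat.succ_le_succ (Nat.zero_le l)) hl
    have hprev : P.state (2 * (e + (l + 1))) =
        gibbs (x.temp Th Tc) (isothermalHam A B m l) := hstate l (Nat.le_of_succ_le hl)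
    rw [Finset.sum_range_succ, ih (Nat.le_of_succ_le hl), P.mul_heat_of_contact hHint h1, h2,
      P.entropyAt_succ_of_evolution hop, P.state_succ_of_evolution hop, conjugate_one,
      Finset.sum_range_succ]
    simp only [entropyAt]
    rw [hstate (l + 1) hl, hprev]
    ring

variable {P : Cycle Hint Th Tc} {U V : Matrix.unitaryGroup (∀ j, κ j) ℂ}
  {A B C D : Operator κ} {m : ℕ}

lemma IsCarnotLike.exists_evolution (h : P.IsCarnotLike U V A B C D m) {k : ℕ}
    (hk : k < 2 * (m + 1)) : ∃ W, P.op (2 * k) = .evolution W := by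
  rcases Nat.lt_or_ge k (m + 1) with h1 | h1
  · rcases Nat.eq_zero_or_pos k with rfl | h2
    · exact ⟨V, h.evolution_V⟩
    · exact ⟨1, h.hot_quench k h2 (by omega)⟩
  · obtain ⟨j, rfl⟩ := Nat.exists_eq_add_of_le h1
    rcases Nat.eq_zero_or_pos j with rfl | h2
    · exact ⟨U, h.evolution_U⟩
    · exact ⟨1, h.cold_quench j h2 (by omega)⟩

lemma IsCarnotLike.sum_range_period (h : P.IsCarnotLike U V A B C D m) {f : ℕ → ℝ}
    (hf : ∀ {i W}, P.op i = .evolution W → f i = 0) :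
    ∑ i ∈ Finset.range P.period, f i = ∑ j ∈ Finset.range (m + 1), f (2 * j + 1) +
      ∑ j ∈ Finset.range (m + 1), f (2 * (m + 1 + j) + 1) := by
  have hp : P.period = 2 * (m + 1 + (m + 1)) := by rw [h.period_eq]; ring
  rw [hp, sum_range_two_mul, ← Finset.sum_range_add]
  refine Finset.sum_congr rfl fun k hk => ?_
  obtain ⟨W, hW⟩ := h.exists_evolution (k := k) (by have := Finset.mem_range.mp hk; omega)
  rw [hf hW, zero_add]

lemma IsCarnotLike.sum_entropyHot (h : P.IsCarnotLike U V A B C D m) (hHint : Hint.IsHermitian)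
    (hm : m ≠ 0) :
    ∑ i ∈ Finset.range P.period, P.entropyHot i =
      deltaS Th Tc B D - dissipation V Tc D Th A - isothermalLoss Th A B m := by
  have hs0 : P.state 0 = gibbs Tc D := by
    obtain ⟨h1, h2⟩ := h.cold_contact m le_rfl
    have h3 := P.state_succ_of_contact h1
    have h4 := P.state_periodic 0
    rw [h.period_eq, show 0 + 4 * (m + 1) = 2 * (m + 1 + m) + 1 + 1 by ring, h3, h2] at h4
    rw [← h4]
    exact congrArg _ (isothermalHam_self C D hm)
  have key := P.sum_heat_isothermal hHint (x := .hot) (A := A) (B := B) (m := m) (e := 0)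
    h.evolution_V (by simp only [zero_add]; exact h.hot_contact)
    (by simpa only [zero_add] using h.hot_quench) le_rfl
  simp only [zero_add, mul_zero, isothermalHam_zero, isothermalHam_self A B hm, Bath.temp,
    entropyAt, hs0] at key
  rw [h.sum_range_period P.entropyHot_of_evolution,
    Finset.sum_eq_zero (s := Finset.range (m + 1)) (f := fun j => P.entropyHot (2 * (m + 1 + j) + 1))
      fun j hj => P.entropyHot_of_cold (h.cold_contact j (by
        have := Finset.mem_range.mp hj; omega)).1, add_zero]
  refine Eq.trans (Finset.sum_congr rfl fun j hj => ?_) key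
  rw [entropyHot, (h.hot_contact j (by have := Finset.mem_range.mp hj; omega)).1]

lemma IsCarnotLike.sum_entropyCold (h : P.IsCarnotLike U V A B C D m) (hHint : Hint.IsHermitian)
    (hm : m ≠ 0) :
    ∑ i ∈ Finset.range P.period, P.entropyCold i =
      -(deltaS Th Tc B D + dissipation U Th B Tc C) - isothermalLoss Tc C D m := by
  have hs : P.state (2 * (m + 1)) = gibbs Th B := by
    obtain ⟨h1, h2⟩ := h.hot_contact m le_rfl
    have h3 := P.state_succ_of_contact h1
    rw [h2] at h3
    exact h3.trans (congrArg _ (isothermalHam_self A B hm))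
  have key := P.sum_heat_isothermal hHint (x := .cold) (A := C) (B := D) (m := m) (e := m + 1)
    h.evolution_U h.cold_contact h.cold_quench le_rfl
  simp only [isothermalHam_zero, isothermalHam_self C D hm, Bath.temp, entropyAt, hs] at key
  rw [h.sum_range_period P.entropyCold_of_evolution,
    Finset.sum_eq_zero (s := Finset.range (m + 1)) (f := fun j => P.entropyCold (2 * j + 1))
      fun j hj => P.entropyCold_of_hot (h.hot_contact j (by
        have := Finset.mem_range.mp hj; omega)).1, zero_add]
  have hgoal : -(deltaS Th Tc B D + dissipation U Th B Tc C) - isothermalLoss Tc C D m =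
      entropy (gibbs Tc D) - entropy (gibbs Th B) - dissipation U Th B Tc C -
        isothermalLoss Tc C D m := by
    rw [deltaS]; ring
  rw [hgoal]
  refine Eq.trans (Finset.sum_congr rfl fun j hj => ?_) key
  rw [entropyCold, (h.cold_contact j (by have := Finset.mem_range.mp hj; omega)).1]

end Cycle

/-! ### Existence of Carnot-like protocols -/

section Construction

variable {ι : Type*} [Fintype ι] [DecidableEq ι]
  {κ : ι → Type*} [∀ j, Fintype (κ j)] [∀ j, DecidableEq (κ j)] [∀ j, Nonempty (κ j)]

/-- The cycle in which evolutions `W k`, from the Hamiltonian `K k` to `K (k + 1)`, alternate with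
contacts at `K (k + 1)` with the bath `b (k + 1)`, for given sequences of period `M`. -/
noncomputable def alternatingCycle (Hint : Operator κ) (hHint : Hint.IsHermitian) (Th Tc : ℝ)
    (M : ℕ) (hM : 0 < M) (W : ℕ → Matrix.unitaryGroup (∀ j, κ j) ℂ) (b : ℕ → Bath)
    (K : ℕ → Operator κ) (hW : ∀ k, W k ∈ reachable Hint) (hK : ∀ k, IsAdmissible Hint (K k))
    (hWM : ∀ k, W (k + M) = W k) (hbM : ∀ k, b (k + M) = b k) (hKM : ∀ k, K (k + M) = K k) :
    Cycle Hint Th Tc where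
  period := 2 * M
  op i := if i % 2 = 0 then .evolution (W (i / 2)) else .contact (b (i / 2 + 1))
  state i := if i % 2 = 0 then gibbs ((b (i / 2)).temp Th Tc) (K (i / 2))
    else conjugate (W (i / 2)) (gibbs ((b (i / 2)).temp Th Tc) (K (i / 2)))
  ham i := K ((i + 1) / 2)
  period_pos := by omega
  isState i := by
    have h := isState_gibbs ((b (i / 2)).temp Th Tc) ((hK (i / 2)).isHermitian hHint)
    split_ifs
    · exact h
    · exact h.conjugate _
  isAdmissible i := hK _
  effect i := by
    obtain ⟨k, rfl | rfl⟩ := Nat.even_or_odd' i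
    · have h1 : (2 * k) % 2 = 0 := by omega
      have h2 : (2 * k + 1) % 2 ≠ 0 := by omega
      have h3 : 2 * k / 2 = k := by omega
      have h4 : (2 * k + 1) / 2 = k := by omega
      rw [if_pos h1, if_pos h1, if_neg h2, h3, h4]
      exact ⟨hW k, rfl⟩
    · have h1 : (2 * k + 1 + 1) % 2 = 0 := by omega
      have h2 : (2 * k + 1) % 2 ≠ 0 := by omega
      have h3 : (2 * k + 1 + 1) / 2 = k + 1 := by omega
      have h4 : (2 * k + 1) / 2 = k := by omega
      have h5 : (2 * k + 1 + 1 + 1) / 2 = k + 1 := by omega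
      rw [if_pos h1, if_neg h2, if_neg h2, h3, h4, h5]
      exact ⟨rfl, rfl⟩
  op_periodic i := by
    have h1 : (i + 2 * M) % 2 = i % 2 := by omega
    have h2 : (i + 2 * M) / 2 = i / 2 + M := by omega
    rw [h1, h2, hWM, add_right_comm, hbM]
  state_periodic i := by
    have h1 : (i + 2 * M) % 2 = i % 2 := by omega
    have h2 : (i + 2 * M) / 2 = i / 2 + M := by omega
    rw [h1, h2, hWM, hbM, hKM]
  ham_periodic i := by
    have h2 : (i + 2 * M + 1) / 2 = (i + 1) / 2 + M := by omega
    rw [h2, hKM]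

lemma exists_isCarnotLike {Hint : Operator κ} (hHint : Hint.IsHermitian) (Th Tc : ℝ)
    {A B C D : Operator κ} (hA : IsAdmissible Hint A) (hB : IsAdmissible Hint B)
    (hC : IsAdmissible Hint C) (hD : IsAdmissible Hint D)
    {U V : Matrix.unitaryGroup (∀ j, κ j) ℂ} (hU : U ∈ reachable Hint) (hV : V ∈ reachable Hint)
    {m : ℕ} (hm : m ≠ 0) : ∃ P : Cycle Hint Th Tc, P.IsCarnotLike U V A B C D m := by
  set M : ℕ := 2 * (m + 1) with hMdef
  -- the contacts `1, …, m + 1` are hot, the contacts `m + 2, …, 2 m + 2 ≡ 0` are cold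
  set W : ℕ → Matrix.unitaryGroup (∀ j, κ j) ℂ := fun k =>
    if k % M = 0 then V else if k % M = m + 1 then U else 1 with hWdef
  set b : ℕ → Bath := fun k => if 1 ≤ k % M ∧ k % M ≤ m + 1 then .hot else .cold with hbdef
  set K : ℕ → Operator κ := fun k =>
    if k % M = 0 then D else if k % M ≤ m + 1 then isothermalHam A B m (k % M - 1)
      else isothermalHam C D m (k % M - (m + 2)) with hKdef
  have hW : ∀ k, W k ∈ reachable Hint := by
    intro k
    simp only [hWdef]
    split_ifs
    exacts [hV, hU, one_mem_reachable Hint]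
  have hK : ∀ k, IsAdmissible Hint (K k) := by
    intro k
    simp only [hKdef]
    split_ifs
    exacts [hD, isAdmissible_isothermalHam hA hB _ _, isAdmissible_isothermalHam hC hD _ _]
  refine ⟨alternatingCycle Hint hHint Th Tc M (by omega) W b K hW hK
    (fun k => by simp [hWdef]) (fun k => by simp [hbdef]) (fun k => by simp [hKdef]),
    ?_, ?_, ?_, ?_, ?_, ?_, ?_⟩
  · simp only [alternatingCycle, hMdef]
    ring
  · simp [alternatingCycle, hWdef]
  · intro j hj
    have h1 : (2 * j + 1) % 2 ≠ 0 := by omega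
    have h2 : (2 * j + 1) / 2 + 1 = j + 1 := by omega
    have h3 : (2 * j + 1 + 1) / 2 = j + 1 := by omega
    have h4 : (j + 1) % M = j + 1 := Nat.mod_eq_of_lt (by omega)
    constructor
    · simp only [alternatingCycle, if_neg h1, h2, hbdef, h4]
      rw [if_pos (by omega)]
    · simp only [alternatingCycle, h3, hKdef, h4]
      rw [if_neg (by omega), if_pos (by omega), Nat.add_sub_cancel]
      rfl
  · intro j hj hj'
    have h1 : (2 * j) % 2 = 0 := by omega
    have h2 : 2 * j / 2 = j := by omega
    have h4 : j % M = j := Nat.mod_eq_of_lt (by omega)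
    simp only [alternatingCycle, if_pos h1, h2, hWdef, h4]
    rw [if_neg (by omega), if_neg (by omega)]
  · have h1 : (2 * (m + 1)) % 2 = 0 := by omega
    have h2 : 2 * (m + 1) / 2 = m + 1 := by omega
    have h4 : (m + 1) % M = m + 1 := Nat.mod_eq_of_lt (by omega)
    simp only [alternatingCycle, if_pos h1, h2, hWdef, h4]
    rw [if_neg (by omega), if_pos True.intro]
  · intro j hj
    have h1 : (2 * (m + 1 + j) + 1) % 2 ≠ 0 := by omega
    have h2 : (2 * (m + 1 + j) + 1) / 2 + 1 = m + 1 + j + 1 := by omega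
    have h3 : (2 * (m + 1 + j) + 1 + 1) / 2 = m + 1 + j + 1 := by omega
    rcases Nat.lt_or_eq_of_le hj with hj | rfl
    · have h4 : (m + 1 + j + 1) % M = m + 1 + j + 1 := Nat.mod_eq_of_lt (by omega)
      constructor
      · simp only [alternatingCycle, if_neg h1, h2, hbdef, h4]
        rw [if_neg (by omega)]
      · simp only [alternatingCycle, h3, hKdef, h4]
        rw [if_neg (by omega), if_neg (by omega),
          show m + 1 + j + 1 - (m + 2) = j by omega]
        rfl
    · have h4 : (j + 1 + j + 1) % M = 0 := by
        rw [show j + 1 + j + 1 = M by omega, Nat.mod_self]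
      constructor
      · simp only [alternatingCycle, if_neg h1, h2, hbdef, h4]
        rw [if_neg (by omega)]
      · simp only [alternatingCycle, h3, hKdef, h4, if_true]
        exact (isothermalHam_self C D hm).symm
  · intro j hj hj'
    have h1 : (2 * (m + 1 + j)) % 2 = 0 := by omega
    have h2 : 2 * (m + 1 + j) / 2 = m + 1 + j := by omega
    have h4 : (m + 1 + j) % M = m + 1 + j := Nat.mod_eq_of_lt (by omega)
    simp only [alternatingCycle, if_pos h1, h2, hWdef, h4]
    rw [if_neg (by omega), if_neg (by omega)]

end Construction

/-! ### Efficiencies and their limits -/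

namespace Cycle

variable {ι : Type*} [Fintype ι] [DecidableEq ι]
  {κ : ι → Type*} [∀ j, Fintype (κ j)] [∀ j, DecidableEq (κ j)]
  {Hint : Operator κ} {Th Tc : ℝ}

lemma heatHot_pos_iff (P : Cycle Hint Th Tc) (hTh : 0 < Th) :
    0 < P.heatHot ↔ 0 < ∑ i ∈ Finset.range P.period, P.entropyHot i := by
  rw [P.heatHot_eq hTh.ne', mul_pos_iff_of_pos_left hTh]

lemma efficiency_eq (P : Cycle Hint Th Tc) (hTh : 0 < Th) (hTc : Tc ≠ 0) (h : 0 < P.heatHot) :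
    P.efficiency = 1 - Tc / Th * (-(∑ i ∈ Finset.range P.period, P.entropyCold i) /
      ∑ i ∈ Finset.range P.period, P.entropyHot i) := by
  have hX := (P.heatHot_pos_iff hTh).mp h
  rw [efficiency, abs_of_pos h, P.work_eq hTh.ne' hTc, P.heatHot_eq hTh.ne']
  field_simp
  ring

variable [∀ j, Nonempty (κ j)]

lemma heatHot_pos_of_work_pos (P : Cycle Hint Th Tc) (hHint : Hint.IsHermitian) (hTc : 0 < Tc)
    (hTh : Tc < Th) (hW : 0 < P.work) : 0 < P.heatHot := by
  have hTh0 := hTc.trans hTh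
  rw [P.heatHot_pos_iff hTh0]
  rw [P.work_eq hTh0.ne' hTc.ne'] at hW
  have hsecond := P.sum_entropyHot_add_sum_entropyCold_nonpos hHint
  by_contra! h
  nlinarith

lemma efficiency_le_of_heatHot_pos (P : Cycle Hint Th Tc) (hHint : Hint.IsHermitian)
    (hTc : 0 < Tc) (hTh : Tc < Th) (h : 0 < P.heatHot) :
    ∃ a b c d : ℕ, P.IsHotRun a b c d ∧
      0 < deltaS Th Tc (P.ham b) (P.ham d) - minDissipation Hint Tc (P.ham d) Th (P.ham a) ∧
      P.efficiency ≤ 1 - Tc / Th *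
        ((deltaS Th Tc (P.ham b) (P.ham d) + minDissipation Hint Th (P.ham b) Tc (P.ham c)) /
         (deltaS Th Tc (P.ham b) (P.ham d) -
            minDissipation Hint Tc (P.ham d) Th (P.ham a))) := by
  have hTh0 := hTc.trans hTh
  have hX := (P.heatHot_pos_iff hTh0).mp h
  obtain ⟨a, b, c, d, hrun, hgain, hle⟩ :=
    P.exists_isHotRun hHint hX (div_mul_cancel₀ _ hX.ne')
  have hS : P.entropyAt (b + 1) - P.entropyAt (d + 1) = deltaS Th Tc (P.ham b) (P.ham d) := by
    obtain ⟨-, -, -, hd, -, hb, -⟩ := hrun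
    rw [entropyAt, entropyAt, P.state_succ_of_contact hb, P.state_succ_of_contact hd]
    rfl
  rw [gain, hS] at hgain hle
  refine ⟨a, b, c, d, hrun, hgain, ?_⟩
  rw [P.efficiency_eq hTh0 hTc.ne' h]
  exact sub_le_sub_left (mul_le_mul_of_nonneg_left ((div_le_iff₀ hgain).mpr hle)
    (div_nonneg hTc.le hTh0.le)) _

open Filter Topology in
lemma tendsto_efficiency_of_isCarnotLike (hHint : Hint.IsHermitian) (hTh : 0 < Th) (hTc : Tc ≠ 0)
    {A B C D : Operator κ} (hA : IsAdmissible Hint A) (hB : IsAdmissible Hint B)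
    (hC : IsAdmissible Hint C) (hD : IsAdmissible Hint D)
    {U V : Matrix.unitaryGroup (∀ j, κ j) ℂ}
    (hpos : 0 < deltaS Th Tc B D - dissipation V Tc D Th A)
    {P : ℕ → Cycle Hint Th Tc} (hP : ∀ m, (P m).IsCarnotLike U V A B C D (m + 1)) :
    (∀ᶠ m in atTop, 0 < (P m).heatHot) ∧
      Tendsto (fun m => (P m).efficiency) atTop
        (𝓝 (1 - Tc / Th * ((deltaS Th Tc B D + dissipation U Th B Tc C) /
          (deltaS Th Tc B D - dissipation V Tc D Th A)))) := by
  have hhot : Tendsto (fun m => ∑ i ∈ Finset.range (P m).period, (P m).entropyHot i) atTop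
      (𝓝 (deltaS Th Tc B D - dissipation V Tc D Th A)) := by
    have h := ((tendsto_isothermalLoss hHint hA hB Th).comp (tendsto_add_atTop_nat 1)).const_sub
      (deltaS Th Tc B D - dissipation V Tc D Th A)
    rw [sub_zero] at h
    exact h.congr fun m => ((hP m).sum_entropyHot hHint m.succ_ne_zero).symm
  have hcold : Tendsto (fun m => -∑ i ∈ Finset.range (P m).period, (P m).entropyCold i) atTop
      (𝓝 (deltaS Th Tc B D + dissipation U Th B Tc C)) := by
    have h := ((tendsto_isothermalLoss hHint hC hD Tc).comp (tendsto_add_atTop_nat 1)).const_add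
      (deltaS Th Tc B D + dissipation U Th B Tc C)
    rw [add_zero] at h
    refine h.congr fun m => ?_
    rw [(hP m).sum_entropyCold hHint m.succ_ne_zero, Function.comp_apply]
    ring
  have hheat : ∀ᶠ m in atTop, 0 < (P m).heatHot := by
    filter_upwards [hhot.eventually_const_lt hpos] with m hm
    exact ((P m).heatHot_pos_iff hTh).mpr hm
  refine ⟨hheat, (((hcold.div hhot hpos.ne').const_mul (Tc / Th)).const_sub 1).congr' ?_⟩
  filter_upwards [hheat] with m hm
  exact ((P m).efficiency_eq hTh hTc hm).symm

end Cycle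

section Saturation

variable {ι : Type*} [Fintype ι] [DecidableEq ι]
  {κ : ι → Type*} [∀ j, Fintype (κ j)] [∀ j, DecidableEq (κ j)] [∀ j, Nonempty (κ j)]

open Filter Topology in
lemma exists_tendsto_dissipation {Hint : Operator κ} (T T' : ℝ) {H H' : Operator κ}
    (hH : H.IsHermitian) (hH' : H'.IsHermitian) :
    ∃ U : ℕ → Matrix.unitaryGroup (∀ j, κ j) ℂ, (∀ n, U n ∈ reachable Hint) ∧
      Tendsto (fun n => dissipation (U n) T H T' H') atTop
        (𝓝 (minDissipation Hint T H T' H')) := by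
  have hex : ∀ n : ℕ, ∃ U ∈ reachable Hint, dissipation U T H T' H' <
      minDissipation Hint T H T' H' + 1 / ((n : ℝ) + 1) := fun n =>
    exists_dissipation_lt Hint T T' H H' (lt_add_of_pos_right _ Nat.one_div_pos_of_nat)
  choose U hU hlt using hex
  refine ⟨U, hU, ?_⟩
  have h := (tendsto_one_div_add_atTop_nhds_zero_nat (𝕜 := ℝ)).const_add
    (minDissipation Hint T H T' H')
  rw [add_zero] at h
  exact tendsto_of_tendsto_of_tendsto_of_le_of_le tendsto_const_nhds h
    (fun n => minDissipation_le (hU n) T T' hH hH') fun n => (hlt n).le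

end Saturation

end QEngine

open QEngine Filter Topology
theorem theorem1 {ι : Type*} [Fintype ι] [DecidableEq ι]
    {κ : ι → Type*} [∀ j, Fintype (κ j)] [∀ j, DecidableEq (κ j)] [∀ j, Nonempty (κ j)]
    (Hint : Operator κ) (hHint : Hint.IsHermitian)
    (Th Tc : ℝ) (hTc : 0 < Tc) (hTh : Tc < Th) :
    -- the bound, for all cyclic protocols in which the hot bath provides heat
    (∀ P : Cycle Hint Th Tc,
      (0 < P.work → 0 < P.heatHot) ∧
      (0 < P.heatHot →
        ∃ a b c d : ℕ, P.IsHotRun a b c d ∧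
          0 < deltaS Th Tc (P.ham b) (P.ham d) - minDissipation Hint Tc (P.ham d) Th (P.ham a) ∧
          P.efficiency ≤ 1 - Tc / Th *
            ((deltaS Th Tc (P.ham b) (P.ham d) + minDissipation Hint Th (P.ham b) Tc (P.ham c)) /
             (deltaS Th Tc (P.ham b) (P.ham d) -
                minDissipation Hint Tc (P.ham d) Th (P.ham a))))) ∧
    -- Carnot-like protocols, for any reachable `U`, `V`, in the limit of slow isothermals
    (∀ A B C D : Operator κ, IsAdmissible Hint A → IsAdmissible Hint B →
      IsAdmissible Hint C → IsAdmissible Hint D →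
      ∀ U ∈ reachable Hint, ∀ V ∈ reachable Hint,
        0 < deltaS Th Tc B D - dissipation V Tc D Th A →
        ∃ P : ℕ → Cycle Hint Th Tc,
          (∀ m, (P m).IsCarnotLike U V A B C D (m + 1)) ∧
          (∀ᶠ m in atTop, 0 < (P m).heatHot) ∧
          Tendsto (fun m => (P m).efficiency) atTop
            (𝓝 (1 - Tc / Th *
              ((deltaS Th Tc B D + dissipation U Th B Tc C) /
               (deltaS Th Tc B D - dissipation V Tc D Th A))))) ∧
    -- hence saturation of the bound
    (∀ A B C D : Operator κ, IsAdmissible Hint A → IsAdmissible Hint B →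
      IsAdmissible Hint C → IsAdmissible Hint D →
      0 < deltaS Th Tc B D - minDissipation Hint Tc D Th A →
      ∀ ε : ℝ, 0 < ε →
        ∃ U ∈ reachable Hint, ∃ V ∈ reachable Hint, ∃ m : ℕ, 1 ≤ m ∧ ∃ P : Cycle Hint Th Tc,
          P.IsCarnotLike U V A B C D m ∧ 0 < P.heatHot ∧
          |P.efficiency - (1 - Tc / Th *
            ((deltaS Th Tc B D + minDissipation Hint Th B Tc C) /
             (deltaS Th Tc B D - minDissipation Hint Tc D Th A)))| < ε) := by

  have hTh0 : 0 < Th := hTc.trans hTh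
  have hCarnot : ∀ A B C D : Operator κ, IsAdmissible Hint A → IsAdmissible Hint B →
      IsAdmissible Hint C → IsAdmissible Hint D →
      ∀ U ∈ reachable Hint, ∀ V ∈ reachable Hint,
        0 < deltaS Th Tc B D - dissipation V Tc D Th A →
        ∃ P : ℕ → Cycle Hint Th Tc,
          (∀ m, (P m).IsCarnotLike U V A B C D (m + 1)) ∧
          (∀ᶠ m in atTop, 0 < (P m).heatHot) ∧
          Tendsto (fun m => (P m).efficiency) atTop
            (𝓝 (1 - Tc / Th *
              ((deltaS Th Tc B D + dissipation U Th B Tc C) /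
               (deltaS Th Tc B D - dissipation V Tc D Th A)))) := by
    intro A B C D hA hB hC hD U hU V hV hpos
    choose P hP using fun m : ℕ =>
      exists_isCarnotLike hHint Th Tc hA hB hC hD hU hV m.succ_ne_zero
    exact ⟨P, hP,
      Cycle.tendsto_efficiency_of_isCarnotLike hHint hTh0 hTc.ne' hA hB hC hD hpos hP⟩
  refine ⟨fun P => ⟨P.heatHot_pos_of_work_pos hHint hTc hTh,
    P.efficiency_le_of_heatHot_pos hHint hTc hTh⟩, hCarnot, ?_⟩
  intro A B C D hA hB hC hD hpos ε hε
  obtain ⟨U, hU, hUlim⟩ := exists_tendsto_dissipation (Hint := Hint) Th Tc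
    (hB.isHermitian hHint) (hC.isHermitian hHint)
  obtain ⟨V, hV, hVlim⟩ := exists_tendsto_dissipation (Hint := Hint) Tc Th
    (hD.isHermitian hHint) (hA.isHermitian hHint)
  have hden := hVlim.const_sub (deltaS Th Tc B D)
  have hlim := ((((hUlim.const_add (deltaS Th Tc B D)).div hden hpos.ne').const_mul
    (Tc / Th)).const_sub 1).eventually (Metric.ball_mem_nhds _ (half_pos hε))
  obtain ⟨n, hn, hnpos⟩ := (hlim.and (hden.eventually_const_lt hpos)).exists
  obtain ⟨P, hP, hheat, heff⟩ := hCarnot A B C D hA hB hC hD (U n) (hU n) (V n) (hV n) hnpos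
  obtain ⟨m, hm, hmheat⟩ :=
    ((heff.eventually (Metric.ball_mem_nhds _ (half_pos hε))).and hheat).exists
  refine ⟨U n, hU n, V n, hV n, m + 1, Nat.le_add_left 1 m, P m, hP m, hmheat, ?_⟩
  -- the limits are taken one after the other: first over `U`, `V`, then over the step number
  have h := (dist_triangle _ _ _).trans_lt (add_lt_add hm hn)
  rwa [add_halves] at h
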